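/- Let $0\le m\le n$ and $\mathfrak g=\mathfrak{gl}(m|n)$ over $\mathbb C$, with matrix units $e_{i,j}$, $i,j\in I=\{\bar 1,\dots,\bar m;1,\dots,n\}$, parities $|\bar a|=0$, $|a|=1$, and columns $\mathrm{col}(\bar a)=\mathrm{col}(a)=a$. Let $V=\mathbb C^{m|n}$ be the natural module, let $e=\sum_{a=1}^{m-1}e_{\bar a,\overline{a+1}}+\sum_{a=1}^{n-1}e_{a,a+1}$ be the principal nilpotent element, $\chi(x)=\mathrm{str}(ex)$, $\mathfrak m=\sum_{\mathrm{col}(i)>\mathrm{col}(j)}\mathbb C e_{i,j}$, let $I_\chi$ be the left ideal of $U(\mathfrak g)$ generated by all $x-\chi(x)$, $x\in\mathfrak m$, and put $Q_\chi=U(\mathfrak g)/I_\chi$ with generator $1_\chi$, and $W_\chi=\mathrm{End}_{U(\mathfrak g)}(Q_\chi)^{\mathrm{op}}$ (the principal finite $W$-superalgebra). All modules are left supermodules and all morphisms are even. For a $\mathfrak g$-module $L$ let $\mathrm{Wh}(L)=\{v\in L: xv=\chi(x)v\ \forall x\in\mathfrak m\}$, which is a $W_\chi$-module: if $w\in W_\chi$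 sends $1_\chi$ to $y1_\chi$, then $wv=yv$. For a $W_\chi$-module $M$ and a finite-dimensional $\mathfrak g$-module $X$ put $$M\circledast X=\mathrm{Wh}\big((Q_\chi\otimes_{W_\chi}M)\otimes X\big).$$ For a $\mathfrak g$-module $L$ and a finite-dimensional $\mathfrak g$-module $X$ let $\Omega$ act on $L\otimes X$ by $$\Omega(l\otimes v)=\sum_{i,j\in I}(-1)^{|j|+(|i|+|j|)|l|}\,e_{i,j}l\otimes e_{j,i}v .$$ Let $x$ be the endomorphism of the functor $-\circledast V$ whose value $x_M$ is the restriction of $\Omega$ to $M\circledast V\subseteq (Q_\chi\otimes_{W_\chi}M)\otimes V$. Let $\alpha_M:(M\circledast V)\circledast V\to M\circledast(V\otimes V)$ be the map $$\big(u'1_\chi\otimes((u1_\chi\otimes m)\otimes v)\big)\otimes v'\mapsto u'\big((u1_\chi\otimes m)\otimes v\big)\otimes v',$$ let $\widehat s_M$ be the endomorphism of $M\circledast (V\otimes V)$ given by the action of $\Omega$ on the factor $V\otimes V$, that is, by $v\otimes v'\mapsto(-1)^{|v||v'|}v'\otimes v$, and put $s_M=\alpha_M^{-1}\circ\widehat s_M\circ\alpha_M$.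 For $d\ge 0$ let $-\circledast V^{\circledast d}$ be the $d$-th power of the functor $-\circledast V$, with natural endomorphisms $x_i=\mathbf 1^{d-i}x\mathbf 1^{i-1}$ $(1\le i\le d)$ and $s_j=\mathbf 1^{d-j-1}s\mathbf 1^{j-1}$ $(1\le j\le d-1)$; thus $(x_i)_M$ is obtained by applying $(-\circledast V)^{d-i}$ to $x_{M\circledast V^{\circledast (i-1)}}$, and $(s_j)_M$ by applying $(-\circledast V)^{d-j-1}$ to $s_{M\circledast V^{\circledast(j-1)}}$. **Theorem.** The natural transformation $\alpha$ is an isomorphism (so that $s$ is defined), and the natural endomorphisms $x_i,s_j$ of $-\circledast V^{\circledast d}$ satisfy the defining relations of the degenerate affine Hecke algebra $H_d$: $$s_i^2=1,\qquad s_is_{i+1}s_i=s_{i+1}s_is_{i+1},\qquad s_is_j=s_js_i\ (|i-j|>1),$$ $$x_js_i=s_ix_j\ (j\ne i,i+1),\qquad x_{i+1}s_i-s_ix_i=1,\qquad x_ix_j=x_jx_i .$$ Consequently, for every $W_\chi$-module $M$ there is a unique algebra homomorphism $H_d\to\mathrm{End}_{W_\chi}(M\circledast V^{\circledast d})^{\mathrm{op}}$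 (that is, a right action of $H_d$ on $M\circledast V^{\circledast d}$ by $W_\chi$-module endomorphisms) sending the generators $x_i,s_j$ to $(x_i)_M,(s_j)_M$. -/

import Mathlib

open CategoryTheory
open scoped TensorProduct

universe u

noncomputable section

namespace PrincipalW

/-! ### Superalgebras and supermodules over the complex numbers

A `ℤ/2`-grading `M = M₀ ⊕ M₁` of a complex vector space is the same thing as a linear involution
`π` of `M`: the even part is the `+1` eigenspace and the odd part is the `-1` eigenspace, that is,
`π v = (-1)^|v| v` for homogeneous `v`.  Gradings are recorded through this involution. -/

/-- A superalgebra: an associative unital complex algebra with a `ℤ/2`-grading, recorded by the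
parity automorphism `a ↦ (-1)^|a| a`. -/
class Superalgebra (A : Type*) [Ring A] [Algebra ℂ A] where
  parity : A →ₐ[ℂ] A
  parity_parity : ∀ a, parity (parity a) = a

/-- A (left) supermodule over a superalgebra `A`: a superspace with an action `ρ` of `A` such that
`|a v| = |a| + |v|`. -/
structure SMod (A : Type) [Ring A] [Algebra ℂ A] [Superalgebra A] where
  carrier : Type u
  [grp : AddCommGroup carrier]
  [mod : Module ℂ carrier]
  /-- the action of the algebra -/
  ρ : A →ₐ[ℂ] Module.End ℂ carrier
  /-- the parity involution `v ↦ (-1)^|v| v` -/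
  π : Module.End ℂ carrier
  π_π : ∀ v, π (π v) = v
  π_ρ : ∀ a v, π (ρ a v) = ρ (Superalgebra.parity a) (π v)

attribute [instance] SMod.grp SMod.mod

section Category

variable {A : Type} [Ring A] [Algebra ℂ A] [Superalgebra A]

/-- Homomorphisms of supermodules are the even `A`-linear maps. -/
@[ext]
structure SMod.Hom (M N : SMod.{u} A) where
  toLin : M.carrier →ₗ[ℂ] N.carrier
  map_ρ : ∀ a v, toLin (M.ρ a v) = N.ρ a (toLin v)
  map_π : ∀ v, toLin (M.π v) = N.π (toLin v)

instance : Category (SMod.{u} A) where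
  Hom M N := SMod.Hom M N
  id M := ⟨LinearMap.id, fun _ _ => rfl, fun _ => rfl⟩
  comp f g := ⟨g.toLin ∘ₗ f.toLin, fun a v => by simp [f.map_ρ, g.map_ρ],
    fun v => by simp [f.map_π, g.map_π]⟩

/-- The linear map underlying a morphism. -/
def SMod.lin {M N : SMod.{u} A} (f : M ⟶ N) : M.carrier →ₗ[ℂ] N.carrier := SMod.Hom.toLin f

/-- Constructor of morphisms. -/
def SMod.mk' {M N : SMod.{u} A} (f : M.carrier →ₗ[ℂ] N.carrier)
    (h₁ : ∀ a v, f (M.ρ a v) = N.ρ a (f v)) (h₂ : ∀ v, f (M.π v) = N.π (f v)) : M ⟶ N :=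
  SMod.Hom.mk f h₁ h₂

@[simp] lemma SMod.lin_mk' {M N : SMod.{u} A} (f : M.carrier →ₗ[ℂ] N.carrier) (h₁ h₂) :
    SMod.lin (SMod.mk' (M := M) (N := N) f h₁ h₂) = f := rfl

lemma SMod.lin_injective {M N : SMod.{u} A} :
    Function.Injective (SMod.lin : (M ⟶ N) → (M.carrier →ₗ[ℂ] N.carrier)) :=
  fun _ _ h => SMod.Hom.ext h

lemma SMod.hom_ext {M N : SMod.{u} A} {f g : M ⟶ N} (h : ∀ v, SMod.lin f v = SMod.lin g v) :
    f = g := SMod.lin_injective (LinearMap.ext h)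

@[simp] lemma SMod.lin_id (M : SMod.{u} A) : SMod.lin (𝟙 M) = LinearMap.id := rfl

@[simp] lemma SMod.lin_comp {M N P : SMod.{u} A} (f : M ⟶ N) (g : N ⟶ P) :
    SMod.lin (f ≫ g) = SMod.lin g ∘ₗ SMod.lin f := rfl

lemma SMod.lin_ρ {M N : SMod.{u} A} (f : M ⟶ N) (a : A) (v : M.carrier) :
    SMod.lin f (M.ρ a v) = N.ρ a (SMod.lin f v) := SMod.Hom.map_ρ f a v

lemma SMod.lin_π {M N : SMod.{u} A} (f : M ⟶ N) (v : M.carrier) :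
    SMod.lin f (M.π v) = N.π (SMod.lin f v) := SMod.Hom.map_π f v

section Linear

variable {M N : SMod.{u} A}

instance : Zero (M ⟶ N) := ⟨SMod.mk' 0 (by simp) (by simp)⟩
instance : Add (M ⟶ N) := ⟨fun f g => SMod.mk' (SMod.lin f + SMod.lin g)
  (by simp [SMod.lin_ρ]) (by simp [SMod.lin_π])⟩
instance : Neg (M ⟶ N) := ⟨fun f => SMod.mk' (-SMod.lin f)
  (by simp [SMod.lin_ρ]) (by simp [SMod.lin_π])⟩
instance : Sub (M ⟶ N) := ⟨fun f g => SMod.mk' (SMod.lin f - SMod.lin g)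
  (by simp [SMod.lin_ρ]) (by simp [SMod.lin_π])⟩
instance : SMul ℕ (M ⟶ N) := ⟨fun c f => SMod.mk' (c • SMod.lin f)
  (by simp [SMod.lin_ρ]) (by simp [SMod.lin_π])⟩
instance : SMul ℤ (M ⟶ N) := ⟨fun c f => SMod.mk' (c • SMod.lin f)
  (by simp [SMod.lin_ρ]) (by simp [SMod.lin_π])⟩
instance : SMul ℂ (M ⟶ N) := ⟨fun c f => SMod.mk' (c • SMod.lin f)
  (by simp [SMod.lin_ρ]) (by simp [SMod.lin_π])⟩

instance : AddCommGroup (M ⟶ N) :=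
  Function.Injective.addCommGroup SMod.lin SMod.lin_injective rfl (fun _ _ => rfl) (fun _ => rfl)
    (fun _ _ => rfl) (fun _ _ => rfl) (fun _ _ => rfl)

/-- `SMod.lin` as an additive map. -/
def SMod.linAddHom (M N : SMod.{u} A) : (M ⟶ N) →+ (M.carrier →ₗ[ℂ] N.carrier) where
  toFun := SMod.lin
  map_zero' := rfl
  map_add' _ _ := rfl

instance : Module ℂ (M ⟶ N) :=
  Function.Injective.module ℂ (SMod.linAddHom M N) SMod.lin_injective (fun _ _ => rfl)

end Linear

instance : Preadditive (SMod.{u} A) where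
  add_comp _ _ _ f f' g := SMod.lin_injective (LinearMap.comp_add _ _ (SMod.lin g))
  comp_add _ _ _ f g g' := SMod.lin_injective (LinearMap.add_comp (SMod.lin f) _ _)

@[simp] lemma SMod.lin_smul {M N : SMod.{u} A} (c : ℂ) (f : M ⟶ N) :
    SMod.lin (c • f) = c • SMod.lin f := rfl

instance : Linear ℂ (SMod.{u} A) where
  homModule _ _ := inferInstance
  smul_comp _ _ _ r _ g := SMod.hom_ext fun _ => map_smul (SMod.lin g) r _
  comp_smul _ _ _ _ _ _ := SMod.hom_ext fun _ => rfl

end Category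

/-! ### The Lie superalgebra `𝔤𝔩(m|n)` and its universal enveloping superalgebra -/

/-- The index set `I(m|n) = {1̄, …, m̄; 1, …, n}`. -/
abbrev I (m n : ℕ) : Type := Fin m ⊕ Fin n

variable {m n : ℕ}

/-- The parity of an index: barred indices are even, unbarred ones are odd. -/
def par : I m n → ℕ
  | Sum.inl _ => 0
  | Sum.inr _ => 1

/-- The column of an index in the left-justified pyramid with rows of length `m` and `n`
(columns are numbered from `0`; only differences of columns matter). -/
def col : I m n → ℕ
  | Sum.inl i => i
  | Sum.inr j => j

/-- The parity (as a natural number; only its class mod 2 matters) of the matrix unit `e_{i,j}`. -/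
def epar (i j : I m n) : ℕ := par i + par j

/-- The defining relations of `U(𝔤𝔩(m|n))`:
`e_{ij} e_{kl} - (-1)^{|e_{ij}||e_{kl}|} e_{kl} e_{ij}
  = δ_{jk} e_{il} - (-1)^{|e_{ij}||e_{kl}|} δ_{il} e_{kj}`. -/
inductive URel (m n : ℕ) : FreeAlgebra ℂ (I m n × I m n) → FreeAlgebra ℂ (I m n × I m n) → Prop
  | comm (i j k l : I m n) : URel m n
      (FreeAlgebra.ι ℂ (i, j) * FreeAlgebra.ι ℂ (k, l)
        - (-1 : ℂ) ^ (epar i j * epar k l) • (FreeAlgebra.ι ℂ (k, l) * FreeAlgebra.ι ℂ (i, j)))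
      ((if j = k then FreeAlgebra.ι ℂ (i, l) else 0)
        - (-1 : ℂ) ^ (epar i j * epar k l) • (if i = l then FreeAlgebra.ι ℂ (k, j) else 0))

/-- The universal enveloping superalgebra `U(𝔤)` of `𝔤 = 𝔤𝔩(m|n)`. -/
def U (m n : ℕ) : Type := RingQuot (URel m n)

instance : Ring (U m n) := inferInstanceAs (Ring (RingQuot (URel m n)))
instance : Algebra ℂ (U m n) := inferInstanceAs (Algebra ℂ (RingQuot (URel m n)))

/-- The matrix unit `e_{i,j}` as an element of `U(𝔤)`. -/
def e (i j : I m n) : U m n := RingQuot.mkAlgHom ℂ (URel m n) (FreeAlgebra.ι ℂ (i, j))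

lemma e_comm (i j k l : I m n) :
    e i j * e k l - (-1 : ℂ) ^ (epar i j * epar k l) • (e k l * e i j)
      = (if j = k then e i l else 0)
        - (-1 : ℂ) ^ (epar i j * epar k l) • (if i = l then e k j else 0) := by
  have h := RingQuot.mkAlgHom_rel ℂ (URel.comm i j k l)
  simp only [map_sub, map_mul, map_smul, apply_ite (RingQuot.mkAlgHom ℂ (URel m n)),
    map_zero] at h
  exact h

/-- The universal property of `U(𝔤)`. -/
def U.lift {B : Type*} [Ring B] [Algebra ℂ B] (f : I m n → I m n → B)
    (hf : ∀ i j k l, f i j * f k l - (-1 : ℂ) ^ (epar i j * epar k l) • (f k l * f i j)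
      = (if j = k then f i l else 0)
        - (-1 : ℂ) ^ (epar i j * epar k l) • (if i = l then f k j else 0)) : U m n →ₐ[ℂ] B :=
  RingQuot.liftAlgHom ℂ ⟨FreeAlgebra.lift ℂ (fun p : I m n × I m n => f p.1 p.2), by
    rintro _ _ ⟨i, j, k, l⟩
    simp only [map_sub, map_mul, map_smul, FreeAlgebra.lift_ι_apply,
      apply_ite (FreeAlgebra.lift ℂ (fun p : I m n × I m n => f p.1 p.2)), map_zero]
    exact hf i j k l⟩

@[simp] lemma U.lift_e {B : Type*} [Ring B] [Algebra ℂ B] (f : I m n → I m n → B) (hf)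
    (i j : I m n) : U.lift f hf (e i j) = f i j := by
  unfold U.lift e
  erw [RingQuot.liftAlgHom_mkAlgHom_apply]
  simp

@[elab_as_elim]
lemma U.induction {P : U m n → Prop} (halg : ∀ c : ℂ, P (algebraMap ℂ _ c))
    (he : ∀ i j, P (e i j)) (hmul : ∀ a b, P a → P b → P (a * b))
    (hadd : ∀ a b, P a → P b → P (a + b)) (a : U m n) : P a := by
  obtain ⟨x, rfl⟩ : ∃ x, (RingQuot.mkAlgHom ℂ (URel m n) x : RingQuot (URel m n)) = a :=
    RingQuot.mkAlgHom_surjective ℂ (URel m n) a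
  induction x using FreeAlgebra.induction with
  | grade0 c => rw [AlgHom.commutes]; exact halg c
  | grade1 p => exact he p.1 p.2
  | mul x y hx hy => rw [map_mul]; exact hmul _ _ hx hy
  | add x y hx hy => rw [map_add]; exact hadd _ _ hx hy

lemma par_cases (i : I m n) : par i = 0 ∨ par i = 1 := by
  cases i <;> simp [par]

/-- The parity automorphism of `U(𝔤)`, `e_{ij} ↦ (-1)^{|i|+|j|} e_{ij}`. -/
def U.parityHom (m n : ℕ) : U m n →ₐ[ℂ] U m n :=
  U.lift (fun i j => (-1 : ℂ) ^ epar i j • e i j) (by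
    intro i j k l
    have h := e_comm i j k l
    have e1 : (if j = k then (-1 : ℂ) ^ epar i l • e i l else 0)
        = ((-1 : ℂ) ^ epar i j * (-1) ^ epar k l) • (if j = k then e i l else 0) := by
      split_ifs with hjk
      · subst hjk
        congr 1
        rcases par_cases i with hi | hi <;> rcases par_cases j with hj | hj <;>
          rcases par_cases l with hl | hl <;> simp [epar, hi, hj, hl]
      · simp
    have e2 : (if i = l then (-1 : ℂ) ^ epar k j • e k j else 0)
        = ((-1 : ℂ) ^ epar i j * (-1) ^ epar k l) • (if i = l then e k j else 0) := by
      split_ifs with hjk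
      · subst hjk
        congr 1
        rcases par_cases i with hi | hi <;> rcases par_cases j with hj | hj <;>
          rcases par_cases k with hl | hl <;> simp [epar, hi, hj, hl]
      · simp
    rw [e1, e2, smul_comm _ _ (if i = l then e k j else 0), ← smul_sub, ← h, smul_sub,
      smul_mul_smul_comm, smul_mul_smul_comm, mul_comm ((-1 : ℂ) ^ epar k l), smul_comm])

instance : Superalgebra (U m n) where
  parity := U.parityHom m n
  parity_parity a := by
    induction a using U.induction with
    | halg c => simp
    | he i j =>
      simp only [U.parityHom, U.lift_e, map_smul, smul_smul, ← mul_pow]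
      simp
    | hmul a b ha hb => rw [map_mul, map_mul, ha, hb]
    | hadd a b ha hb => rw [map_add, map_add, ha, hb]

@[simp] lemma parity_e (i j : I m n) :
    Superalgebra.parity (e i j) = (-1 : ℂ) ^ epar i j • e i j := by
  change U.parityHom m n (e i j) = _
  simp [U.parityHom]

/-! ### Supermodules over `U(𝔤)` and their tensor products -/

/-- The parity compatibility may be checked on generators. -/
lemma π_ρ_of_gen {E : Type*} [AddCommGroup E] [Module ℂ E] (ρ : U m n →ₐ[ℂ] Module.End ℂ E)
    (π : Module.End ℂ E) (h : ∀ i j v, π (ρ (e i j) v) = (-1 : ℂ) ^ epar i j • ρ (e i j) (π v)) :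
    ∀ a v, π (ρ a v) = ρ (Superalgebra.parity a) (π v) := by
  intro a
  induction a using U.induction with
  | halg c => intro v; simp [Algebra.algebraMap_eq_smul_one]
  | he i j => intro v; simp [h]
  | hmul a b ha hb => intro v; simp [ha, hb]
  | hadd a b ha hb => intro v; simp [ha, hb]

/-- Linearity over `U(𝔤)` may be checked on generators. -/
lemma map_ρ_of_gen {E F : Type*} [AddCommGroup E] [Module ℂ E] [AddCommGroup F] [Module ℂ F]
    (ρ : U m n →ₐ[ℂ] Module.End ℂ E) (ρ' : U m n →ₐ[ℂ] Module.End ℂ F) (f : E →ₗ[ℂ] F)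
    (h : ∀ i j v, f (ρ (e i j) v) = ρ' (e i j) (f v)) : ∀ a v, f (ρ a v) = ρ' a (f v) := by
  intro a
  induction a using U.induction with
  | halg c => intro v; simp [Algebra.algebraMap_eq_smul_one]
  | he i j => exact h i j
  | hmul a b ha hb => intro v; simp [ha, hb]
  | hadd a b ha hb => intro v; simp [ha, hb]

lemma SMod.π_mul_π (L : SMod.{u} (U m n)) : L.π * L.π = 1 := LinearMap.ext L.π_π

lemma SMod.π_mul_ρ (L : SMod.{u} (U m n)) (i j : I m n) :
    L.π * L.ρ (e i j) = (-1 : ℂ) ^ epar i j • (L.ρ (e i j) * L.π) := by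
  ext v; simp [L.π_ρ]

lemma SMod.π_pow_mul_ρ (L : SMod.{u} (U m n)) (i j : I m n) (p : ℕ) :
    L.π ^ p * L.ρ (e i j) = (-1 : ℂ) ^ (p * epar i j) • (L.ρ (e i j) * L.π ^ p) := by
  induction p with
  | zero => simp
  | succ p ih =>
    rw [pow_succ', mul_assoc, ih, mul_smul_comm, ← mul_assoc, L.π_mul_ρ, smul_mul_assoc, smul_smul,
      mul_assoc, ← pow_succ', ← pow_add]
    congr 2; ring

lemma SMod.ρ_comm (L : SMod.{u} (U m n)) (i j k l : I m n) :
    L.ρ (e i j) * L.ρ (e k l) - (-1 : ℂ) ^ (epar i j * epar k l) • (L.ρ (e k l) * L.ρ (e i j))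
      = (if j = k then L.ρ (e i l) else 0)
        - (-1 : ℂ) ^ (epar i j * epar k l) • (if i = l then L.ρ (e k j) else 0) := by
  have h := congrArg L.ρ (e_comm i j k l)
  simpa only [map_sub, map_mul, map_smul, apply_ite L.ρ, map_zero] using h

lemma SMod.π_pow_congr (L : SMod.{u} (U m n)) {p q : ℕ} (h : p % 2 = q % 2) :
    L.π ^ p = L.π ^ q := by
  have h2 : L.π ^ 2 = 1 := by rw [pow_two, L.π_mul_π]
  rw [← Nat.div_add_mod p 2, ← Nat.div_add_mod q 2, pow_add, pow_add, pow_mul, pow_mul, h2, h]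
  simp

lemma neg_one_pow_sq (p : ℕ) : (-1 : ℂ) ^ p * (-1 : ℂ) ^ p = 1 := by
  rw [← mul_pow]; simp

/-- The action of `e_{ij}` on a tensor product `L ⊗ X` of supermodules,
`x (l ⊗ v) = x l ⊗ v + (-1)^{|x||l|} l ⊗ x v`. -/
def tensGen (L : SMod.{u} (U m n)) (X : SMod.{0} (U m n)) (i j : I m n) :
    Module.End ℂ (L.carrier ⊗[ℂ] X.carrier) :=
  TensorProduct.map (L.ρ (e i j)) 1 + TensorProduct.map (L.π ^ epar i j) (X.ρ (e i j))

lemma tensGen_rel (L : SMod.{u} (U m n)) (X : SMod.{0} (U m n)) (i j k l : I m n) :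
    tensGen L X i j * tensGen L X k l
        - (-1 : ℂ) ^ (epar i j * epar k l) • (tensGen L X k l * tensGen L X i j)
      = (if j = k then tensGen L X i l else 0)
        - (-1 : ℂ) ^ (epar i j * epar k l) • (if i = l then tensGen L X k j else 0) := by
  set s : ℂ := (-1 : ℂ) ^ (epar i j * epar k l) with hs
  have hss : s * s = 1 := neg_one_pow_sq _
  have h1 : TensorProduct.map (L.ρ (e i j) * L.ρ (e k l) - s • (L.ρ (e k l) * L.ρ (e i j)))
        (1 : Module.End ℂ X.carrier)
      + TensorProduct.map (L.π ^ (epar i j + epar k l))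
        (X.ρ (e i j) * X.ρ (e k l) - s • (X.ρ (e k l) * X.ρ (e i j)))
      = tensGen L X i j * tensGen L X k l - s • (tensGen L X k l * tensGen L X i j) := by
    simp only [tensGen, mul_add, add_mul, ← TensorProduct.map_mul, one_mul, mul_one,
      L.π_pow_mul_ρ]
    rw [mul_comm (epar k l), ← hs]
    simp only [sub_eq_add_neg, ← neg_smul, TensorProduct.map_add_left, TensorProduct.map_add_right,
      TensorProduct.map_smul_left, TensorProduct.map_smul_right, smul_add, smul_smul, ← pow_add,
      add_comm (epar k l)]
    simp only [hss]
    module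
  rw [← h1, L.ρ_comm, X.ρ_comm]
  have e1 : TensorProduct.map (L.π ^ (epar i j + epar k l))
      (if j = k then X.ρ (e i l) else 0)
      = if j = k then TensorProduct.map (L.π ^ epar i l) (X.ρ (e i l)) else 0 := by
    split_ifs with h
    · subst h
      rw [L.π_pow_congr]
      simp only [epar]; omega
    · simp
  have e2 : TensorProduct.map (L.π ^ (epar i j + epar k l))
      (if i = l then X.ρ (e k j) else 0)
      = if i = l then TensorProduct.map (L.π ^ epar k j) (X.ρ (e k j)) else 0 := by
    split_ifs with h
    · subst h
      rw [L.π_pow_congr]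
      simp only [epar]; omega
    · simp
  simp only [sub_eq_add_neg, ← neg_smul, TensorProduct.map_add_left, TensorProduct.map_add_right,
    TensorProduct.map_smul_left, TensorProduct.map_smul_right, ← hs, e1, e2]
  simp only [tensGen]
  split_ifs <;> simp <;> module

/-- The action of `U(𝔤)` on a tensor product. -/
def tensρ (L : SMod.{u} (U m n)) (X : SMod.{0} (U m n)) :
    U m n →ₐ[ℂ] Module.End ℂ (L.carrier ⊗[ℂ] X.carrier) :=
  U.lift (tensGen L X) (tensGen_rel L X)

lemma SMod.π_π_pow (L : SMod.{u} (U m n)) (p : ℕ) (y : L.carrier) :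
    L.π ((L.π ^ p) y) = (L.π ^ p) (L.π y) := by
  rw [← Module.End.mul_apply, ← Module.End.mul_apply, ← pow_succ, ← pow_succ']

/-- The tensor product of two supermodules over `U(𝔤)`. -/
def tens (L : SMod.{u} (U m n)) (X : SMod.{0} (U m n)) : SMod.{u} (U m n) where
  carrier := L.carrier ⊗[ℂ] X.carrier
  ρ := tensρ L X
  π := TensorProduct.map L.π X.π
  π_π v := by
    induction v using TensorProduct.induction_on with
    | zero => simp
    | tmul x y => simp [L.π_π, X.π_π]
    | add x y hx hy => simp only [map_add, hx, hy]
  π_ρ := by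
    refine π_ρ_of_gen _ _ fun i j v => ?_
    induction v using TensorProduct.induction_on with
    | zero => simp
    | tmul x y =>
      simp [tensρ, tensGen, L.π_ρ, X.π_ρ, SMod.π_π_pow, TensorProduct.smul_tmul']
    | add x y hx hy => simp only [map_add, hx, hy, smul_add]

lemma tensρ_e (L : SMod.{u} (U m n)) (X : SMod.{0} (U m n)) (i j : I m n) :
    tensρ L X (e i j) = tensGen L X i j := by
  simp [tensρ]

lemma lin_π_pow {M N : SMod.{u} (U m n)} (f : M ⟶ N) (p : ℕ) (v : M.carrier) :
    SMod.lin f ((M.π ^ p) v) = (N.π ^ p) (SMod.lin f v) := by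
  induction p generalizing v with
  | zero => simp
  | succ p ih => rw [pow_succ, pow_succ, Module.End.mul_apply, ih, SMod.lin_π]; rfl

/-- Constructor of morphisms between tensor products. -/
def tensMk {L L' : SMod.{u} (U m n)} {X X' : SMod.{0} (U m n)}
    (f : L.carrier ⊗[ℂ] X.carrier →ₗ[ℂ] L'.carrier ⊗[ℂ] X'.carrier)
    (h₁ : ∀ i j, f ∘ₗ tensGen L X i j = tensGen L' X' i j ∘ₗ f)
    (h₂ : f ∘ₗ TensorProduct.map L.π X.π = TensorProduct.map L'.π X'.π ∘ₗ f) :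
    tens L X ⟶ tens L' X' :=
  SMod.mk' (M := tens L X) (N := tens L' X') f
    (map_ρ_of_gen (tensρ L X) (tensρ L' X') f fun i j v => by
      rw [tensρ_e, tensρ_e]; exact LinearMap.congr_fun (h₁ i j) v)
    (fun v => LinearMap.congr_fun h₂ v)

/-- A pair of morphisms induces a morphism of tensor products. -/
def tensMap {L L' : SMod.{u} (U m n)} {X X' : SMod.{0} (U m n)} (f : L ⟶ L') (g : X ⟶ X') :
    tens L X ⟶ tens L' X' :=
  tensMk (TensorProduct.map (SMod.lin f) (SMod.lin g))
    (fun i j => TensorProduct.ext' fun x y => by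
      simp [tensGen, SMod.lin_ρ, lin_π_pow])
    (TensorProduct.ext' fun x y => by simp [SMod.lin_π])

lemma tens_hom_ext {L L' : SMod.{u} (U m n)} {X X' : SMod.{0} (U m n)}
    {f g : tens L X ⟶ tens L' X'}
    (h : ∀ (x : L.carrier) (y : X.carrier),
      (SMod.lin f : L.carrier ⊗[ℂ] X.carrier →ₗ[ℂ] L'.carrier ⊗[ℂ] X'.carrier) (x ⊗ₜ y)
        = (SMod.lin g : L.carrier ⊗[ℂ] X.carrier →ₗ[ℂ] L'.carrier ⊗[ℂ] X'.carrier) (x ⊗ₜ y)) :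
    f = g :=
  SMod.lin_injective (TensorProduct.ext' (M := L.carrier) (N := X.carrier) h)

/-- The functor `- ⊗ X` on supermodules over `U(𝔤)`. -/
def tensR (X : SMod.{0} (U m n)) : SMod.{u} (U m n) ⥤ SMod.{u} (U m n) where
  obj L := tens L X
  map f := tensMap f (𝟙 X)
  map_id L := tens_hom_ext fun _ _ => rfl
  map_comp f g := tens_hom_ext fun _ _ => rfl

/-- A morphism `X ⟶ Y` induces a natural transformation `- ⊗ X ⟶ - ⊗ Y`. -/
def tensL {X Y : SMod.{0} (U m n)} (g : X ⟶ Y) :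
    (tensR X : SMod.{u} (U m n) ⥤ SMod.{u} (U m n)) ⟶ tensR Y where
  app L := tensMap (𝟙 L) g
  naturality L L' f := tens_hom_ext fun _ _ => rfl

lemma tens_π_pow (L : SMod.{u} (U m n)) (X : SMod.{0} (U m n)) (p : ℕ)
    (x : L.carrier) (y : X.carrier) :
    ((tens L X).π ^ p : Module.End ℂ (L.carrier ⊗[ℂ] X.carrier)) (x ⊗ₜ[ℂ] y)
      = (L.π ^ p) x ⊗ₜ[ℂ] (X.π ^ p) y := by
  have h : ((tens L X).π ^ p : Module.End ℂ (L.carrier ⊗[ℂ] X.carrier))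
      = TensorProduct.map (L.π ^ p) (X.π ^ p) := TensorProduct.map_pow _ _ _
  rw [h]; rfl

lemma tens_ρ_e (L : SMod.{u} (U m n)) (X : SMod.{0} (U m n)) (i j : I m n)
    (x : L.carrier) (y : X.carrier) :
    ((tens L X).ρ (e i j) : Module.End ℂ (L.carrier ⊗[ℂ] X.carrier)) (x ⊗ₜ[ℂ] y)
      = L.ρ (e i j) x ⊗ₜ[ℂ] y + (L.π ^ epar i j) x ⊗ₜ[ℂ] X.ρ (e i j) y := by
  change tensρ L X (e i j) (x ⊗ₜ[ℂ] y) = _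
  rw [tensρ_e]; rfl

lemma assoc_aux {E F G : Type*} [AddCommGroup E] [Module ℂ E] [AddCommGroup F] [Module ℂ F]
    [AddCommGroup G] [Module ℂ G] (a b : E) (y w c : F) (z t : G) :
    TensorProduct.assoc ℂ E F G ((a ⊗ₜ[ℂ] y + b ⊗ₜ[ℂ] w) ⊗ₜ[ℂ] z + (b ⊗ₜ[ℂ] c) ⊗ₜ[ℂ] t)
      = a ⊗ₜ[ℂ] (y ⊗ₜ[ℂ] z) + b ⊗ₜ[ℂ] (w ⊗ₜ[ℂ] z + c ⊗ₜ[ℂ] t) := by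
  rw [TensorProduct.add_tmul, map_add, map_add, TensorProduct.assoc_tmul,
    TensorProduct.assoc_tmul, TensorProduct.assoc_tmul, TensorProduct.tmul_add, add_assoc]

/-- The associativity morphism `(L ⊗ X) ⊗ Y ⟶ L ⊗ (X ⊗ Y)`, `(l ⊗ x) ⊗ y ↦ l ⊗ (x ⊗ y)`. -/
def tensAssoc (L : SMod.{u} (U m n)) (X Y : SMod.{0} (U m n)) :
    tens (tens L X) Y ⟶ tens L (tens X Y) :=
  tensMk (L := tens L X) (X' := tens X Y)
    (TensorProduct.assoc ℂ L.carrier X.carrier Y.carrier).toLinearMap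
    (fun i j => TensorProduct.ext_threefold (M := L.carrier) (N := X.carrier) (P := Y.carrier)
      fun x y z => by
        change TensorProduct.assoc ℂ L.carrier X.carrier Y.carrier
          (((tens L X).ρ (e i j) : Module.End ℂ (L.carrier ⊗[ℂ] X.carrier)) (x ⊗ₜ[ℂ] y) ⊗ₜ[ℂ] z
            + ((tens L X).π ^ epar i j : Module.End ℂ (L.carrier ⊗[ℂ] X.carrier)) (x ⊗ₜ[ℂ] y)
              ⊗ₜ[ℂ] Y.ρ (e i j) z)
          = L.ρ (e i j) x ⊗ₜ[ℂ] (y ⊗ₜ[ℂ] z)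
            + TensorProduct.tmul (N := X.carrier ⊗[ℂ] Y.carrier) ℂ ((L.π ^ epar i j) x)
              (((tens X Y).ρ (e i j) : Module.End ℂ (X.carrier ⊗[ℂ] Y.carrier)) (y ⊗ₜ[ℂ] z))
        rw [tens_ρ_e, tens_ρ_e, tens_π_pow]
        exact assoc_aux _ _ _ _ _ _ _)
    (TensorProduct.ext_threefold (M := L.carrier) (N := X.carrier) (P := Y.carrier)
      fun x y z => rfl)

/-- The associativity as a natural transformation. -/
def assocNat (X Y : SMod.{0} (U m n)) :
    (tensR X ⋙ tensR Y : SMod.{u} (U m n) ⥤ SMod.{u} (U m n)) ⟶ tensR (tens X Y) where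
  app L := tensAssoc L X Y
  naturality L L' f := SMod.lin_injective
    (TensorProduct.ext_threefold (M := L.carrier) (N := X.carrier) (P := Y.carrier)
      fun _ _ _ => rfl)

/-! ### The operator `Ω` -/

/-- Left multiplication by `Ω = ∑ (-1)^{|j|} e_{ij} ⊗ e_{ji}` on `L ⊗ X`:
`Ω (l ⊗ v) = ∑ (-1)^{|j| + (|i|+|j|)|l|} e_{ij} l ⊗ e_{ji} v`. -/
def omegaLin (L : SMod.{u} (U m n)) (X : SMod.{0} (U m n)) :
    Module.End ℂ (L.carrier ⊗[ℂ] X.carrier) :=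
  ∑ i : I m n, ∑ j : I m n, (-1 : ℂ) ^ par j •
    TensorProduct.map (L.ρ (e i j) * L.π ^ epar i j) (X.ρ (e j i))

lemma smul_commutator {B : Type*} [Ring B] [Algebra ℂ B] (c : ℂ) (a T : B) :
    a * (c • T) - (c • T) * a = c • (a * T - T * a) := by
  rw [mul_smul_comm, smul_mul_assoc, smul_sub]

lemma tensGen_omega (L : SMod.{u} (U m n)) (X : SMod.{0} (U m n)) (k l : I m n) :
    tensGen L X k l * omegaLin L X = omegaLin L X * tensGen L X k l := by
  rw [← sub_eq_zero]
  have h1 : ∀ i j : I m n,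
      tensGen L X k l * ((-1 : ℂ) ^ par j •
          TensorProduct.map (L.ρ (e i j) * L.π ^ epar i j) (X.ρ (e j i)))
        - ((-1 : ℂ) ^ par j •
          TensorProduct.map (L.ρ (e i j) * L.π ^ epar i j) (X.ρ (e j i))) * tensGen L X k l
      = ((if l = i then (-1 : ℂ) ^ par j • TensorProduct.map (L.ρ (e k j) * L.π ^ epar l j)
            (X.ρ (e j l)) else 0)
          - (if i = k then (-1 : ℂ) ^ par j • TensorProduct.map (L.ρ (e k j) * L.π ^ epar l j)
            (X.ρ (e j l)) else 0))
        + ((if l = j then (-1 : ℂ) ^ (par l + epar k l * epar i l) •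
              TensorProduct.map (L.ρ (e i l) * L.π ^ epar i k) (X.ρ (e k i)) else 0)
          - (if j = k then (-1 : ℂ) ^ (par l + epar k l * epar i l) •
              TensorProduct.map (L.ρ (e i l) * L.π ^ epar i k) (X.ρ (e k i)) else 0)) := by
    intro i j
    set s : ℂ := (-1 : ℂ) ^ (epar k l * epar i j) with hs
    have hss : s * s = 1 := neg_one_pow_sq _
    have hji : epar j i = epar i j := add_comm _ _
    have hX := X.ρ_comm k l j i
    have hL := L.ρ_comm k l i j
    rw [hji, ← hs] at hX
    rw [← hs] at hL
    have h2 : tensGen L X k l *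
          TensorProduct.map (L.ρ (e i j) * L.π ^ epar i j) (X.ρ (e j i))
        - TensorProduct.map (L.ρ (e i j) * L.π ^ epar i j) (X.ρ (e j i)) * tensGen L X k l
        = TensorProduct.map ((L.ρ (e k l) * L.ρ (e i j) - s • (L.ρ (e i j) * L.ρ (e k l)))
            * L.π ^ epar i j) (X.ρ (e j i))
          + s • TensorProduct.map (L.ρ (e i j) * L.π ^ (epar k l + epar i j))
            (X.ρ (e k l) * X.ρ (e j i) - s • (X.ρ (e j i) * X.ρ (e k l))) := by
      have p1 : L.π ^ epar k l * (L.ρ (e i j) * L.π ^ epar i j)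
          = s • (L.ρ (e i j) * L.π ^ (epar k l + epar i j)) := by
        rw [← mul_assoc, L.π_pow_mul_ρ, smul_mul_assoc, mul_assoc, ← pow_add]
      have p2 : L.ρ (e i j) * L.π ^ epar i j * L.ρ (e k l)
          = s • (L.ρ (e i j) * L.ρ (e k l) * L.π ^ epar i j) := by
        rw [mul_assoc, L.π_pow_mul_ρ, mul_smul_comm, ← mul_assoc, mul_comm (epar i j)]
      have p3 : L.ρ (e i j) * L.π ^ epar i j * L.π ^ epar k l
          = L.ρ (e i j) * L.π ^ (epar k l + epar i j) := by
        rw [mul_assoc, ← pow_add, add_comm]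
      simp only [tensGen, mul_add, add_mul, ← TensorProduct.map_mul, one_mul, mul_one, p1, p2, p3]
      simp only [sub_eq_add_neg, ← neg_smul, TensorProduct.map_add_left, add_mul, smul_mul_assoc,
        TensorProduct.map_add_right, mul_assoc,
        TensorProduct.map_smul_left, TensorProduct.map_smul_right, smul_add, smul_smul]
      simp only [mul_neg, hss]
      module
    refine ((smul_commutator _ _ _).trans (congrArg _ h2)).trans ?_
    rw [hL, hX]
    have q1 : TensorProduct.map ((if l = i then L.ρ (e k j) else 0) * L.π ^ epar i j) (X.ρ (e j i))
        = if l = i then TensorProduct.map (L.ρ (e k j) * L.π ^ epar l j) (X.ρ (e j l)) else 0 := by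
      split_ifs with h
      · subst h; rfl
      · simp
    have q2 : TensorProduct.map (L.ρ (e i j) * L.π ^ (epar k l + epar i j))
          (if k = i then X.ρ (e j l) else 0)
        = if i = k then TensorProduct.map (L.ρ (e k j) * L.π ^ epar l j) (X.ρ (e j l)) else 0 := by
      split_ifs with h h' h'
      · subst h
        rw [L.π_pow_congr (p := epar k l + epar k j) (q := epar l j)]
        simp only [epar]; omega
      · exact absurd h.symm h'
      · exact absurd h'.symm h
      · simp
    have q3 : ((-1 : ℂ) ^ par j * s) • TensorProduct.map (L.ρ (e i j) * L.π ^ (epar k l + epar i j))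
          (if l = j then X.ρ (e k i) else 0)
        = if l = j then (-1 : ℂ) ^ (par l + epar k l * epar i l) •
              TensorProduct.map (L.ρ (e i l) * L.π ^ epar i k) (X.ρ (e k i)) else 0 := by
      split_ifs with h
      · subst h
        rw [L.π_pow_congr (p := epar k l + epar i l) (q := epar i k), hs, ← pow_add]
        simp only [epar]; omega
      · simp
    have q4 : ((-1 : ℂ) ^ par j * s) • TensorProduct.map ((if k = j then L.ρ (e i l) else 0)
          * L.π ^ epar i j) (X.ρ (e j i))
        = if j = k then (-1 : ℂ) ^ (par l + epar k l * epar i l) •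
              TensorProduct.map (L.ρ (e i l) * L.π ^ epar i k) (X.ρ (e k i)) else 0 := by
      split_ifs with h h' h'
      · subst h
        congr 1
        rw [hs]
        rcases par_cases i with hi | hi <;> rcases par_cases k with hk | hk <;>
          rcases par_cases l with hl | hl <;> norm_num [epar, hi, hk, hl]
      · exact absurd h.symm h'
      · exact absurd h'.symm h
      · simp
    have e1 : ∀ (P : Prop) [Decidable P] (c : ℂ) (T : Module.End ℂ (L.carrier ⊗[ℂ] X.carrier)),
        (if P then c • T else 0) = c • (if P then T else 0) := by
      intro P _ c T; split_ifs <;> simp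
    rw [← q3, ← q4, e1 (l = i), e1 (i = k), ← q1, ← q2]
    simp only [sub_eq_add_neg, ← neg_smul, TensorProduct.map_add_left, add_mul, smul_mul_assoc,
      TensorProduct.map_add_right, TensorProduct.map_smul_left, TensorProduct.map_smul_right,
      smul_add, smul_smul]
    simp only [mul_neg, hss]
    module
  unfold omegaLin
  simp only [Finset.mul_sum, Finset.sum_mul, ← Finset.sum_sub_distrib, h1]
  simp [Finset.sum_add_distrib, Finset.sum_sub_distrib]

/-- Left multiplication by `Ω`, as an endomorphism of the supermodule `L ⊗ X`. -/
def omega (L : SMod.{u} (U m n)) (X : SMod.{0} (U m n)) : tens L X ⟶ tens L X :=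
  tensMk (omegaLin L X) (fun i j => (tensGen_omega L X i j).symm)
    (by
      refine TensorProduct.ext' fun x y => ?_
      simp only [omegaLin, LinearMap.comp_apply, LinearMap.sum_apply, map_sum,
        LinearMap.smul_apply, map_smul, TensorProduct.map_tmul, Module.End.mul_apply, L.π_ρ, X.π_ρ,
        parity_e, SMod.π_π_pow, TensorProduct.smul_tmul', TensorProduct.tmul_smul, smul_smul]
      refine Finset.sum_congr rfl fun i _ => Finset.sum_congr rfl fun j _ => ?_
      have h : epar j i = epar i j := add_comm _ _
      rw [h, mul_left_comm, neg_one_pow_sq, mul_one])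

/-- `Ω` as a natural endomorphism of the functor `- ⊗ X`. -/
def omegaNat (X : SMod.{0} (U m n)) :
    (tensR X : SMod.{u} (U m n) ⥤ SMod.{u} (U m n)) ⟶ tensR X where
  app L := omega L X
  naturality L L' f := by
    refine tens_hom_ext fun x y => ?_
    change omegaLin L' X (TensorProduct.map (SMod.lin f) LinearMap.id (x ⊗ₜ y))
      = TensorProduct.map (SMod.lin f) LinearMap.id (omegaLin L X (x ⊗ₜ y))
    simp [omegaLin, SMod.lin_ρ, lin_π_pow]

/-! ### The nilpotent element, `Q_χ` and the finite `W`-superalgebra -/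

/-- The principal nilpotent `e = ∑ e_{ī, \overline{i+1}} + ∑ e_{j, j+1}`. -/
def nilp (m n : ℕ) : Matrix (I m n) (I m n) ℂ
  | Sum.inl a, Sum.inl b => if a.val + 1 = b.val then 1 else 0
  | Sum.inr a, Sum.inr b => if a.val + 1 = b.val then 1 else 0
  | _, _ => 0

/-- The supertrace. -/
def str (x : Matrix (I m n) (I m n) ℂ) : ℂ := ∑ i : I m n, (-1 : ℂ) ^ par i * x i i

/-- The value of `χ = (e, -)` on `e_{ij}`, where `(x, y) = str (x y)`. -/
def chi (i j : I m n) : ℂ := str (nilp m n * Matrix.single i j (1 : ℂ))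

lemma chi_eq (i j : I m n) : chi i j = (-1 : ℂ) ^ par j * nilp m n j i := by
  unfold chi str
  rw [Finset.sum_eq_single j]
  · simp
  · intro k _ hk
    simp [hk.symm, Matrix.mul_apply, Matrix.single_apply]
  · simp

lemma chi_parity (i j : I m n) : (-1 : ℂ) ^ epar i j * chi i j = chi i j := by
  rw [chi_eq]
  cases i <;> cases j <;> simp [nilp, epar, par]

/-- The left ideal `I_χ` of `U(𝔤)` generated by all `x - χ(x)` with
`x ∈ 𝔪 = ∑_{col i > col j} ℂ e_{ij}`. -/
def Ichi (m n : ℕ) : Submodule (U m n) (U m n) :=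
  Submodule.span (U m n)
    {x | ∃ i j : I m n, col j < col i ∧ x = e i j - algebraMap ℂ (U m n) (chi i j)}

/-- The generalized Gelfand-Graev module `Q_χ = U(𝔤) / I_χ`. -/
abbrev Q (m n : ℕ) : Type := U m n ⧸ Ichi m n

/-- The generator `1_χ` of `Q_χ`. -/
def oneChi (m n : ℕ) : Q m n := Submodule.Quotient.mk 1

lemma Q_eq_smul (u : U m n) : (Submodule.Quotient.mk u : Q m n) = u • oneChi m n := by
  rw [oneChi, ← Submodule.Quotient.mk_smul, smul_eq_mul, mul_one]

lemma Q_exists (q : Q m n) : ∃ u : U m n, q = u • oneChi m n := by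
  obtain ⟨u, rfl⟩ := Submodule.Quotient.mk_surjective _ q
  exact ⟨u, Q_eq_smul u⟩

lemma Q_rel {i j : I m n} (h : col j < col i) :
    e i j • oneChi m n = chi i j • oneChi m n := by
  rw [← algebraMap_smul (U m n) (chi i j) (oneChi m n), ← sub_eq_zero, ← sub_smul, ← Q_eq_smul,
    Submodule.Quotient.mk_eq_zero]
  exact Submodule.subset_span ⟨i, j, h, rfl⟩

/-- The parity automorphism of `U(𝔤)` as a semilinear map over itself. -/
def U.parityₛₗ (m n : ℕ) : U m n →ₛₗ[(U.parityHom m n : U m n →+* U m n)] U m n where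
  toFun := U.parityHom m n
  map_add' := map_add _
  map_smul' a b := map_mul (U.parityHom m n) a b

lemma Ichi_parity : Ichi m n ≤ (Ichi m n).comap (U.parityₛₗ m n) := by
  refine Submodule.span_le.2 ?_
  rintro _ ⟨i, j, hij, rfl⟩
  have h : U.parityₛₗ m n (e i j - algebraMap ℂ (U m n) (chi i j))
      = (-1 : ℂ) ^ epar i j • (e i j - algebraMap ℂ (U m n) (chi i j)) := by
    change U.parityHom m n _ = _
    rw [map_sub, AlgHom.commutes, smul_sub, Algebra.algebraMap_eq_smul_one, smul_smul, chi_parity]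
    congr 1
    exact parity_e i j
  change U.parityₛₗ m n _ ∈ Ichi m n
  rw [h, ← algebraMap_smul (U m n)]
  exact Submodule.smul_mem _ _ (Submodule.subset_span ⟨i, j, hij, rfl⟩)

/-- The parity involution of `Q_χ` as a semilinear map. -/
def Qparityₛₗ (m n : ℕ) : Q m n →ₛₗ[(U.parityHom m n : U m n →+* U m n)] Q m n :=
  Submodule.mapQ _ _ (U.parityₛₗ m n) Ichi_parity

lemma Qparityₛₗ_smul_one (u : U m n) :
    Qparityₛₗ m n (u • oneChi m n) = U.parityHom m n u • oneChi m n := by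
  rw [← Q_eq_smul, ← Q_eq_smul]; rfl

lemma U.parity_parity (u : U m n) : U.parityHom m n (U.parityHom m n u) = u :=
  Superalgebra.parity_parity u

lemma Qparity_Qparity (q : Q m n) : Qparityₛₗ m n (Qparityₛₗ m n q) = q := by
  obtain ⟨u, rfl⟩ := Q_exists q
  rw [Qparityₛₗ_smul_one, Qparityₛₗ_smul_one, U.parity_parity]

lemma Qparityₛₗ_csmul (c : ℂ) (q : Q m n) : Qparityₛₗ m n (c • q) = c • Qparityₛₗ m n q := by
  rw [← algebraMap_smul (U m n) c q, map_smulₛₗ, ← algebraMap_smul (U m n) c (Qparityₛₗ m n q)]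
  congr 1
  exact AlgHom.commutes (U.parityHom m n) c

/-- The parity involution of `Q_χ`. -/
def Qparity (m n : ℕ) : Module.End ℂ (Q m n) where
  toFun := Qparityₛₗ m n
  map_add' := map_add _
  map_smul' := Qparityₛₗ_csmul

/-- The finite `W`-superalgebra `W_χ = (End_{U(𝔤)} Q_χ)^op`. -/
abbrev W (m n : ℕ) : Type := (Module.End (U m n) (Q m n))ᵐᵒᵖ

/-- Conjugation of an endomorphism of `Q_χ` by the parity involution. -/
def Wconj (φ : Module.End (U m n) (Q m n)) : Module.End (U m n) (Q m n) where
  toFun q := Qparityₛₗ m n (φ (Qparityₛₗ m n q))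
  map_add' := by simp
  map_smul' a q := by
    rw [map_smulₛₗ, map_smul, map_smulₛₗ]
    congr 1
    exact U.parity_parity a

/-- `Q_χ` is a right `W_χ`-module, and `W_χ` is graded by `|q w| = |q| + |w|`. -/
instance : Superalgebra (W m n) where
  parity :=
    { toFun := fun w => MulOpposite.op (Wconj w.unop)
      map_one' := MulOpposite.unop_injective (LinearMap.ext fun q => Qparity_Qparity q)
      map_mul' := fun a b => MulOpposite.unop_injective (LinearMap.ext fun q => by
        change Qparityₛₗ m n (b.unop (a.unop _)) = Qparityₛₗ m n (b.unop (Qparityₛₗ m n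
          (Qparityₛₗ m n (a.unop _))))
        rw [Qparity_Qparity])
      map_zero' := MulOpposite.unop_injective (LinearMap.ext fun q => map_zero (Qparityₛₗ m n))
      map_add' := fun a b => MulOpposite.unop_injective (LinearMap.ext fun q =>
        map_add (Qparityₛₗ m n) _ _)
      commutes' := fun c => MulOpposite.unop_injective (LinearMap.ext fun q => by
        change Qparityₛₗ m n (c • Qparityₛₗ m n q) = c • q
        rw [Qparityₛₗ_csmul, Qparity_Qparity]) }
  parity_parity a := MulOpposite.unop_injective (LinearMap.ext fun q => by
    change Qparityₛₗ m n (Qparityₛₗ m n (a.unop (Qparityₛₗ m n (Qparityₛₗ m n q)))) = a.unop q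
    rw [Qparity_Qparity, Qparity_Qparity])

/-! ### The functor `Q_χ ⊗_{W_χ} -` -/

/-- The relations `(q w) ⊗ v = q ⊗ (w v)` defining `Q_χ ⊗_{W_χ} M` as a quotient of
`Q_χ ⊗_ℂ M`. -/
def balRel (M : SMod.{u} (W m n)) : Submodule (U m n) (Q m n ⊗[ℂ] M.carrier) :=
  Submodule.span (U m n)
    {x | ∃ (q : Q m n) (w : W m n) (v : M.carrier), x = w.unop q ⊗ₜ[ℂ] v - q ⊗ₜ[ℂ] M.ρ w v}

/-- The underlying space of `Q_χ ⊗_{W_χ} M`. -/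
abbrev QtenCarrier (M : SMod.{u} (W m n)) : Type u := (Q m n ⊗[ℂ] M.carrier) ⧸ balRel M

/-- The pure tensor `q ⊗ v` in `Q_χ ⊗_{W_χ} M`. -/
def qmk {M : SMod.{u} (W m n)} (q : Q m n) (v : M.carrier) : QtenCarrier M :=
  Submodule.Quotient.mk (q ⊗ₜ[ℂ] v)

lemma qmk_bal {M : SMod.{u} (W m n)} (q : Q m n) (w : W m n) (v : M.carrier) :
    (qmk (w.unop q) v : QtenCarrier M) = qmk q (M.ρ w v) :=
  (Submodule.Quotient.eq _).2 (Submodule.subset_span ⟨q, w, v, rfl⟩)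

@[elab_as_elim]
lemma Qten_induction {M : SMod.{u} (W m n)} {P : QtenCarrier M → Prop}
    (h : ∀ q v, P (qmk q v)) (hadd : ∀ x y, P x → P y → P (x + y)) (x : QtenCarrier M) : P x := by
  obtain ⟨x, rfl⟩ := Submodule.Quotient.mk_surjective _ x
  induction x using TensorProduct.induction_on with
  | zero => simpa [qmk] using h 0 0
  | tmul q v => exact h q v
  | add x y hx hy => rw [Submodule.Quotient.mk_add]; exact hadd _ _ hx hy

/-- The parity involution of `Q_χ ⊗_ℂ M` as a semilinear map. -/
def balParityₛₗ (M : SMod.{u} (W m n)) :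
    (Q m n ⊗[ℂ] M.carrier) →ₛₗ[(U.parityHom m n : U m n →+* U m n)] (Q m n ⊗[ℂ] M.carrier) where
  toFun := TensorProduct.map (Qparity m n) M.π
  map_add' := map_add _
  map_smul' a x := by
    induction x using TensorProduct.induction_on with
    | zero => simp
    | tmul q v =>
      rw [TensorProduct.smul_tmul', TensorProduct.map_tmul, TensorProduct.map_tmul,
        TensorProduct.smul_tmul']
      congr 1
      exact map_smulₛₗ (Qparityₛₗ m n) a q
    | add x y hx hy => rw [smul_add, map_add, map_add, smul_add, hx, hy]

lemma balRel_parity (M : SMod.{u} (W m n)) : balRel M ≤ (balRel M).comap (balParityₛₗ M) := by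
  refine Submodule.span_le.2 ?_
  rintro _ ⟨q, w, v, rfl⟩
  refine Submodule.subset_span ⟨Qparity m n q, Superalgebra.parity w, M.π v, ?_⟩
  change TensorProduct.map (Qparity m n) M.π _ = _
  rw [map_sub, TensorProduct.map_tmul, TensorProduct.map_tmul, M.π_ρ]
  congr 2
  change Qparityₛₗ m n (w.unop q) = Qparityₛₗ m n (w.unop (Qparityₛₗ m n (Qparityₛₗ m n q)))
  rw [Qparity_Qparity]

/-- The parity involution of `Q_χ ⊗_{W_χ} M` as a semilinear map. -/
def QtenParityₛₗ (M : SMod.{u} (W m n)) :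
    QtenCarrier M →ₛₗ[(U.parityHom m n : U m n →+* U m n)] QtenCarrier M :=
  Submodule.mapQ _ _ (balParityₛₗ M) (balRel_parity M)

lemma QtenParityₛₗ_qmk {M : SMod.{u} (W m n)} (q : Q m n) (v : M.carrier) :
    QtenParityₛₗ M (qmk q v) = qmk (Qparity m n q) (M.π v) := rfl

/-- The `U(𝔤)`-supermodule `Q_χ ⊗_{W_χ} M`. -/
def qtenObj (M : SMod.{u} (W m n)) : SMod.{u} (U m n) where
  carrier := QtenCarrier M
  ρ := Algebra.lsmul ℂ ℂ (QtenCarrier M)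
  π :=
    { toFun := QtenParityₛₗ M
      map_add' := map_add _
      map_smul' := fun c x => by
        rw [← algebraMap_smul (U m n) c x, map_smulₛₗ, RingHom.id_apply,
          ← algebraMap_smul (U m n) c (QtenParityₛₗ M x)]
        congr 1
        exact AlgHom.commutes (U.parityHom m n) c }
  π_π v := by
    change QtenParityₛₗ M (QtenParityₛₗ M v) = v
    induction v using Qten_induction with
    | h q v =>
      rw [QtenParityₛₗ_qmk, QtenParityₛₗ_qmk, M.π_π]
      congr 1
      exact Qparity_Qparity q
    | hadd x y hx hy => rw [map_add, map_add, hx, hy]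
  π_ρ a v := map_smulₛₗ (QtenParityₛₗ M) a v

/-- The map `id ⊗ f` for a morphism `f` of `W_χ`-supermodules. -/
def qtenLin {M N : SMod.{u} (W m n)} (f : M ⟶ N) : QtenCarrier M →ₗ[U m n] QtenCarrier N :=
  Submodule.mapQ _ _
    (TensorProduct.AlgebraTensorModule.map (LinearMap.id : Q m n →ₗ[U m n] Q m n) (SMod.lin f))
    (by
      refine Submodule.span_le.2 ?_
      rintro _ ⟨q, w, v, rfl⟩
      refine Submodule.subset_span ⟨q, w, SMod.lin f v, ?_⟩
      rw [map_sub, TensorProduct.AlgebraTensorModule.map_tmul,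
        TensorProduct.AlgebraTensorModule.map_tmul, SMod.lin_ρ]
      rfl)

lemma qtenLin_qmk {M N : SMod.{u} (W m n)} (f : M ⟶ N) (q : Q m n) (v : M.carrier) :
    qtenLin f (qmk q v) = qmk q (SMod.lin f v) := rfl

/-- The functor `Q_χ ⊗_{W_χ} -` from `W_χ`-supermodules to `U(𝔤)`-supermodules. -/
def qten (m n : ℕ) : SMod.{u} (W m n) ⥤ SMod.{u} (U m n) where
  obj M := qtenObj M
  map {M N} f := SMod.mk' (M := qtenObj M) (N := qtenObj N)
    ((qtenLin f).restrictScalars ℂ)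
    (fun a v => LinearMap.map_smul (qtenLin f) a (show QtenCarrier M from v))
    (fun v => by
      change qtenLin f (QtenParityₛₗ M v) = QtenParityₛₗ N (qtenLin f v)
      induction v using Qten_induction with
      | h q v => rw [QtenParityₛₗ_qmk, qtenLin_qmk, qtenLin_qmk, QtenParityₛₗ_qmk, SMod.lin_π]
      | hadd x y hx hy => simp only [map_add, hx, hy])
  map_id M := SMod.hom_ext fun v => by
    change qtenLin (𝟙 M) v = v
    induction v using Qten_induction with
    | h q v => rfl
    | hadd x y hx hy => rw [map_add, hx, hy]
  map_comp f g := SMod.hom_ext fun v => by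
    change qtenLin (f ≫ g) v = qtenLin g (qtenLin f v)
    induction v using Qten_induction with
    | h q v => rfl
    | hadd x y hx hy => simp only [map_add, hx, hy]

/-! ### The Whittaker functor -/

/-- The space of Whittaker vectors
`Wh(L) = {v ∈ L | x v = χ(x) v for all x ∈ 𝔪}`, with `𝔪 = ∑_{col i > col j} ℂ e_{ij}`. -/
def whSub (L : SMod.{u} (U m n)) : Submodule ℂ L.carrier where
  carrier := {v | ∀ i j : I m n, col j < col i → L.ρ (e i j) v = chi i j • v}
  add_mem' {v w} hv hw i j h := by rw [map_add, hv i j h, hw i j h, smul_add]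
  zero_mem' i j _ := by simp
  smul_mem' c v hv i j h := by rw [map_smul, hv i j h, smul_comm]

/-- The additive map `U(𝔤) → L`, `u ↦ u v`. -/
def orbitHom (L : SMod.{u} (U m n)) (v : L.carrier) : U m n →+ L.carrier where
  toFun u := L.ρ u v
  map_zero' := by simp
  map_add' := by simp

lemma orbitHom_Ichi (L : SMod.{u} (U m n)) (v : whSub L) :
    (Ichi m n).toAddSubgroup ≤ (orbitHom L v.1).ker := by
  intro x hx
  change L.ρ x v.1 = 0
  have hx' : x ∈ Submodule.span (U m n) _ := hx
  clear hx
  induction hx' using Submodule.span_induction with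
  | mem x hx =>
    obtain ⟨i, j, hij, rfl⟩ := hx
    rw [map_sub, LinearMap.sub_apply, v.2 i j hij, AlgHom.commutes, Module.algebraMap_end_apply,
      sub_self]
  | zero => simp
  | add x y _ _ hx hy => rw [map_add, LinearMap.add_apply, hx, hy, add_zero]
  | smul a x _ hx => rw [smul_eq_mul, map_mul, Module.End.mul_apply, hx, map_zero]

/-- For a Whittaker vector `v`, the map `Q_χ → L`, `u 1_χ ↦ u v`. -/
def whEval {L : SMod.{u} (U m n)} (v : whSub L) : Q m n →+ L.carrier :=
  QuotientAddGroup.lift (Ichi m n).toAddSubgroup (orbitHom L v.1) (orbitHom_Ichi L v)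

lemma whEval_smul_one {L : SMod.{u} (U m n)} (v : whSub L) (u : U m n) :
    whEval v (u • oneChi m n) = L.ρ u v.1 := by
  rw [← Q_eq_smul]; rfl

lemma whEval_smul {L : SMod.{u} (U m n)} (v : whSub L) (u : U m n) (q : Q m n) :
    whEval v (u • q) = L.ρ u (whEval v q) := by
  obtain ⟨a, rfl⟩ := Q_exists q
  rw [smul_smul, whEval_smul_one, whEval_smul_one, map_mul, Module.End.mul_apply]

lemma whEval_add {L : SMod.{u} (U m n)} (v w : whSub L) (q : Q m n) :
    whEval (v + w) q = whEval v q + whEval w q := by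
  obtain ⟨a, rfl⟩ := Q_exists q
  simp only [whEval_smul_one, Submodule.coe_add, map_add]

lemma whEval_csmul {L : SMod.{u} (U m n)} (c : ℂ) (v : whSub L) (q : Q m n) :
    whEval (c • v) q = c • whEval v q := by
  obtain ⟨a, rfl⟩ := Q_exists q
  simp only [whEval_smul_one, Submodule.coe_smul, map_smul]

lemma whEval_smul' {L : SMod.{u} (U m n)} (c : ℂ) (v : whSub L) (q : Q m n) :
    whEval v (c • q) = c • whEval v q := by
  rw [← algebraMap_smul (U m n) c q, whEval_smul, AlgHom.commutes, Module.algebraMap_end_apply]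

lemma whEval_mem {L : SMod.{u} (U m n)} (v : whSub L) (w : W m n) :
    whEval v (w.unop (oneChi m n)) ∈ whSub L := by
  intro i j h
  rw [← whEval_smul, ← map_smul, Q_rel h, ← whEval_smul']
  congr 1
  exact LinearMap.map_smul_of_tower w.unop _ _

/-- The action of `w ∈ W_χ` on a Whittaker vector: if `w` is the endomorphism of `Q_χ` sending
`1_χ` to `y 1_χ`, then `w v = y v`. -/
def whAct (L : SMod.{u} (U m n)) (w : W m n) : Module.End ℂ (whSub L) where
  toFun v := ⟨whEval v (w.unop (oneChi m n)), whEval_mem v w⟩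
  map_add' v v' := Subtype.ext (whEval_add v v' _)
  map_smul' c v := Subtype.ext (whEval_csmul c v _)

lemma whEval_whAct {L : SMod.{u} (U m n)} (w : W m n) (v : whSub L) (q : Q m n) :
    whEval (whAct L w v) q = whEval v (w.unop q) := by
  obtain ⟨a, rfl⟩ := Q_exists q
  rw [whEval_smul_one, map_smul, whEval_smul]
  rfl

lemma π_mem_whSub {L : SMod.{u} (U m n)} (v : whSub L) : L.π v.1 ∈ whSub L := by
  intro i j h
  have h1 := L.π_ρ (e i j) v.1
  rw [v.2 i j h, map_smul, parity_e, map_smul, LinearMap.smul_apply] at h1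
  have h2 : (-1 : ℂ) ^ epar i j • ((-1 : ℂ) ^ epar i j • L.ρ (e i j) (L.π v.1))
      = L.ρ (e i j) (L.π v.1) := by
    rw [smul_smul, neg_one_pow_sq, one_smul]
  rw [← h2, ← h1, smul_smul, chi_parity]

lemma whEval_π {L : SMod.{u} (U m n)} (v : whSub L) (q : Q m n) :
    L.π (whEval v q) = whEval ⟨L.π v.1, π_mem_whSub v⟩ (Qparityₛₗ m n q) := by
  obtain ⟨a, rfl⟩ := Q_exists q
  rw [Qparityₛₗ_smul_one, whEval_smul_one, whEval_smul_one]
  exact L.π_ρ a v.1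

lemma Qparityₛₗ_one : Qparityₛₗ m n (oneChi m n) = oneChi m n := by
  have h := Qparityₛₗ_smul_one (m := m) (n := n) 1
  rwa [map_one, one_smul] at h

/-- The `W_χ`-supermodule `Wh(L)`. -/
def whObj (L : SMod.{u} (U m n)) : SMod.{u} (W m n) where
  carrier := whSub L
  ρ :=
    { toFun := whAct L
      map_one' := LinearMap.ext fun v => Subtype.ext (by
        change whEval v (oneChi m n) = v.1
        have h := whEval_smul_one v 1
        rwa [one_smul, map_one] at h)
      map_mul' := fun a b => LinearMap.ext fun v => Subtype.ext (by
        change whEval v (b.unop (a.unop _)) = whEval (whAct L b v) (a.unop _)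
        rw [whEval_whAct])
      map_zero' := LinearMap.ext fun v => Subtype.ext (map_zero (whEval v))
      map_add' := fun a b => LinearMap.ext fun v => Subtype.ext (map_add (whEval v) _ _)
      commutes' := fun c => LinearMap.ext fun v => Subtype.ext (by
        change whEval v (c • oneChi m n) = c • v.1
        have h := whEval_smul_one v 1
        rw [one_smul, map_one] at h
        rw [whEval_smul', h]
        rfl) }
  π :=
    { toFun := fun v => ⟨L.π v.1, π_mem_whSub v⟩
      map_add' := fun v w => Subtype.ext (map_add L.π _ _)
      map_smul' := fun c v => Subtype.ext (map_smul L.π c _) }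
  π_π v := Subtype.ext (L.π_π v.1)
  π_ρ w v := Subtype.ext (by
    change L.π (whEval v (w.unop (oneChi m n)))
      = whEval ⟨L.π v.1, π_mem_whSub v⟩ (Qparityₛₗ m n (w.unop (Qparityₛₗ m n (oneChi m n))))
    rw [whEval_π, Qparityₛₗ_one])

lemma map_mem_whSub {L L' : SMod.{u} (U m n)} (f : L ⟶ L') (v : whSub L) :
    SMod.lin f v.1 ∈ whSub L' := by
  intro i j h
  rw [← SMod.lin_ρ, v.2 i j h, map_smul]

lemma map_whEval {L L' : SMod.{u} (U m n)} (f : L ⟶ L') (v : whSub L) (q : Q m n) :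
    SMod.lin f (whEval v q) = whEval ⟨SMod.lin f v.1, map_mem_whSub f v⟩ q := by
  obtain ⟨a, rfl⟩ := Q_exists q
  rw [whEval_smul_one, whEval_smul_one, SMod.lin_ρ]

/-- The Whittaker functor `Wh` from `U(𝔤)`-supermodules to `W_χ`-supermodules. -/
def wh (m n : ℕ) : SMod.{u} (U m n) ⥤ SMod.{u} (W m n) where
  obj L := whObj L
  map {L L'} f := SMod.mk' (M := whObj L) (N := whObj L')
    { toFun := fun v : whSub L => (⟨SMod.lin f v.1, map_mem_whSub f v⟩ : whSub L')
      map_add' := fun v w => Subtype.ext (map_add (SMod.lin f) _ _)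
      map_smul' := fun c v => Subtype.ext (map_smul (SMod.lin f) c _) }
    (fun w v => Subtype.ext (map_whEval f v _))
    (fun v => Subtype.ext (SMod.lin_π f v.1))
  map_id _ := rfl
  map_comp _ _ := rfl

/-! ### The counit `Q_χ ⊗_{W_χ} Wh(L) → L` -/

/-- The map `Q_χ ⊗_ℂ Wh(L) → L`, `u 1_χ ⊗ v ↦ u v`. -/
def counitLin (L : SMod.{u} (U m n)) : Q m n ⊗[ℂ] (whObj L).carrier →ₗ[ℂ] L.carrier :=
  TensorProduct.lift
    (LinearMap.mk₂ ℂ (fun (q : Q m n) (v : whSub L) => whEval v q)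
      (fun q q' v => map_add (whEval v) q q') (fun c q v => whEval_smul' c v q)
      (fun q v v' => whEval_add v v' q) (fun c q v => whEval_csmul c v q))

lemma counitLin_tmul (L : SMod.{u} (U m n)) (q : Q m n) (v : whSub L) :
    counitLin L (TensorProduct.tmul (N := (whObj L).carrier) ℂ q v) = whEval v q := rfl

lemma counitLin_smul (L : SMod.{u} (U m n)) (a : U m n) (x : Q m n ⊗[ℂ] (whObj L).carrier) :
    counitLin L (a • x) = L.ρ a (counitLin L x) := by
  induction x using TensorProduct.induction_on with
  | zero => simp
  | tmul q v => exact whEval_smul v a q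
  | add x y hx hy => rw [smul_add, map_add, map_add, map_add, hx, hy]

lemma counitLin_bal (L : SMod.{u} (U m n)) :
    (balRel (whObj L)).restrictScalars ℂ ≤ LinearMap.ker (counitLin L) := by
  intro x hx
  change counitLin L x = 0
  have hx' : x ∈ Submodule.span (U m n) _ := hx
  clear hx
  induction hx' using Submodule.span_induction with
  | mem x hx =>
    obtain ⟨q, w, v, rfl⟩ := hx
    rw [map_sub, sub_eq_zero]
    exact (whEval_whAct w v q).symm
  | zero => simp
  | add x y _ _ hx hy => rw [map_add, hx, hy, add_zero]
  | smul a x _ hx => rw [counitLin_smul, hx, map_zero]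

/-- The underlying linear map of the counit. -/
def counitQ (L : SMod.{u} (U m n)) : QtenCarrier (whObj L) →ₗ[ℂ] L.carrier :=
  ((balRel (whObj L)).restrictScalars ℂ).liftQ (counitLin L) (counitLin_bal L) ∘ₗ
    (Submodule.Quotient.restrictScalarsEquiv ℂ (balRel (whObj L))).symm.toLinearMap

lemma counitQ_qmk (L : SMod.{u} (U m n)) (q : Q m n) (v : whSub L) :
    counitQ L (qmk (M := whObj L) q v) = whEval v q := rfl

/-- The morphism `Q_χ ⊗_{W_χ} Wh(L) ⟶ L`, `u 1_χ ⊗ v ↦ u v`. -/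
def counit (L : SMod.{u} (U m n)) : qtenObj (whObj L) ⟶ L :=
  SMod.mk' (M := qtenObj (whObj L)) (counitQ L)
    (fun a x => by
      obtain ⟨x, rfl⟩ := Submodule.Quotient.mk_surjective _ x
      exact counitLin_smul L a x)
    (fun x => by
      change counitQ L (QtenParityₛₗ (whObj L) x) = L.π (counitQ L x)
      induction x using Qten_induction with
      | h q v =>
        rw [QtenParityₛₗ_qmk]
        exact (whEval_π v q).symm
      | hadd x y hx hy => simp only [map_add, hx, hy])

/-- The counit as a natural transformation. -/
def counitNat (m n : ℕ) : wh.{u} m n ⋙ qten m n ⟶ 𝟭 (SMod.{u} (U m n)) where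
  app L := counit L
  naturality L L' f := SMod.hom_ext fun x => by
    have key : ∀ x : QtenCarrier (whObj L),
        counitQ L' (qtenLin (M := whObj L) (N := whObj L') ((wh m n).map f) x)
          = SMod.lin f (counitQ L x) := by
      intro x
      induction x using Qten_induction with
      | h q v => exact (map_whEval f v q).symm
      | hadd x y hx hy => simp only [map_add, hx, hy]
    exact key x

/-! ### The functors `- ⊛ X` and the natural transformations `x`, `s` -/

/-- The functor `- ⊛ X`, `M ⊛ X = Wh((Q_χ ⊗_{W_χ} M) ⊗ X)`. -/
def star (X : SMod.{0} (U m n)) : SMod.{u} (W m n) ⥤ SMod.{u} (W m n) :=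
  qten m n ⋙ tensR X ⋙ wh m n

/-- The natural transformation `α : (M ⊛ X) ⊛ Y ⟶ M ⊛ (X ⊗ Y)`,
`(u' 1_χ ⊗ ((u 1_χ ⊗ m) ⊗ x)) ⊗ y ↦ (u' ((u 1_χ ⊗ m) ⊗ x)) ⊗ y`. -/
def alpha (X Y : SMod.{0} (U m n)) : star.{u} X ⋙ star Y ⟶ star (tens X Y) where
  app M := (wh m n).map ((tensR Y).map (counit (tens (qtenObj M) X)))
    ≫ (wh m n).map (tensAssoc (qtenObj M) X Y)
  naturality _ _ f :=
    (NatTrans.vcomp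
      (F := star.{u} X ⋙ star Y) (G := qten m n ⋙ (tensR X ⋙ tensR Y) ⋙ wh m n)
      (H := star (tens X Y))
      (Functor.whiskerLeft (qten m n ⋙ tensR X)
        (Functor.whiskerRight (counitNat m n) (tensR Y ⋙ wh m n)))
      (Functor.whiskerLeft (qten m n) (Functor.whiskerRight (assocNat X Y) (wh m n)))).naturality f

/-- The natural module `V = ℂ^{m|n}` of `𝔤𝔩(m|n)`; the basis vector `v_a` has parity `|a|`. -/
def V (m n : ℕ) : SMod.{0} (U m n) where
  carrier := I m n → ℂ
  ρ := U.lift (fun i j => Matrix.toLin' (Matrix.single i j (1 : ℂ))) (by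
    intro i j k l
    have h : ∀ i j k l : I m n, Matrix.toLin' (Matrix.single i j (1 : ℂ))
        * Matrix.toLin' (Matrix.single k l (1 : ℂ))
        = if j = k then Matrix.toLin' (Matrix.single i l (1 : ℂ)) else 0 := by
      intro i j k l
      rw [Module.End.mul_eq_comp, ← Matrix.toLin'_mul]
      split_ifs with h
      · subst h; simp
      · simp [Matrix.single_mul_single_of_ne, h]
    rw [h, h]
    simp only [eq_comm (a := l)])
  π := LinearMap.pi fun a => (-1 : ℂ) ^ par a • LinearMap.proj a
  π_π v := by
    ext a
    simp [← mul_assoc, neg_one_pow_sq]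
  π_ρ := by
    refine π_ρ_of_gen _ _ fun i j v => ?_
    ext a
    simp only [U.lift_e, LinearMap.pi_apply, LinearMap.smul_apply, LinearMap.proj_apply,
      Matrix.toLin'_apply, Pi.smul_apply, smul_eq_mul, Matrix.single_mulVec]
    by_cases h : a = i
    · subst h
      simp only [one_mul, Function.update_self, ← mul_assoc, epar, pow_add]
      rw [mul_assoc ((-1 : ℂ) ^ par a), neg_one_pow_sq, mul_one]
    · simp [Function.update_of_ne h]

/-- The functor `- ⊛ V`. -/
abbrev F (m n : ℕ) : SMod.{u} (W m n) ⥤ SMod.{u} (W m n) := star (V m n)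

/-- The natural endomorphism `x` of `- ⊛ V`: left multiplication by `Ω` on
`M ⊛ V ⊆ (Q_χ ⊗_{W_χ} M) ⊗ V`. -/
def xNat (m n : ℕ) : F.{u} m n ⟶ F m n :=
  Functor.whiskerLeft (qten m n) (Functor.whiskerRight (omegaNat (V m n)) (wh m n))

/-- The natural endomorphism `ŝ` of `- ⊛ (V ⊗ V)`: left multiplication by `Ω^{[2,3]}` on
`M ⊛ (V ⊗ V) ⊆ (Q_χ ⊗_{W_χ} M) ⊗ (V ⊗ V)`. -/
def sHat (m n : ℕ) : star.{u} (tens (V m n) (V m n)) ⟶ star (tens (V m n) (V m n)) :=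
  Functor.whiskerLeft (qten m n) (Functor.whiskerRight (tensL (omega (V m n) (V m n))) (wh m n))

open Classical in
/-- The natural endomorphism `s = α⁻¹ ∘ ŝ ∘ α` of `(- ⊛ V) ⊛ V`.  (Composition `≫` is in
diagrammatic order.  If `α` were not invertible, `s` would be `0` by convention.) -/
def sNat (m n : ℕ) : F.{u} m n ⋙ F m n ⟶ F m n ⋙ F m n :=
  if _h : IsIso (alpha.{u} (V m n) (V m n)) then
    alpha (V m n) (V m n) ≫ sHat m n ≫ inv (alpha (V m n) (V m n))
  else 0

/-- The functor `- ⊛ V^{⊛ d}`, the `d`-th power of `- ⊛ V`. -/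
def starPow (m n : ℕ) : ℕ → (SMod.{u} (W m n) ⥤ SMod.{u} (W m n))
  | 0 => 𝟭 _
  | d + 1 => starPow m n d ⋙ F m n

/-- The natural endomorphism `x_i = 1^{d-i} x 1^{i-1}` of `- ⊛ V^{⊛ d}`: on `M`, it is
`(- ⊛ V)^{d-i}` applied to the value of `x` at `M ⊛ V^{⊛ (i-1)}`.
(The index `i` is shifted by one to run over `0, …, d-1`.) -/
def xEnd (m n : ℕ) : (d : ℕ) → Fin d → End (starPow.{u} m n d)
  | d + 1, i =>
    if h : i.val < d then Functor.whiskerRight (xEnd m n d ⟨i.val, h⟩) (F m n)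
    else Functor.whiskerLeft (starPow m n d) (xNat m n)

/-- The natural endomorphism `s_j = 1^{d-j-1} s 1^{j-1}` of `- ⊛ V^{⊛ d}`: on `M`, it is
`(- ⊛ V)^{d-j-1}` applied to the value of `s` at `M ⊛ V^{⊛ (j-1)}`.
(The index `j` is shifted by one to run over `0, …, d-2`.) -/
def sEnd (m n : ℕ) : (d : ℕ) → Fin (d - 1) → End (starPow.{u} m n d)
  | d + 2, j =>
    if h : j.val < d then Functor.whiskerRight (sEnd m n (d + 1) ⟨j.val, h⟩) (F m n)
    else Functor.whiskerLeft (starPow m n d) (sNat m n)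

/-! ### The degenerate affine Hecke algebra -/

/-- The defining relations of the degenerate affine Hecke algebra on `x_i` (`i = 0, …, d-1`) and
`s_i` (`i = 0, …, d-2`; it corresponds to the transposition of `i` and `i+1`). -/
structure DAHARelations {R : Type*} [Ring R] (d : ℕ) (x : Fin d → R) (s : Fin (d - 1) → R) :
    Prop where
  s_sq : ∀ i, s i * s i = 1
  braid : ∀ i j : Fin (d - 1), i.val + 1 = j.val → s i * s j * s i = s j * s i * s j
  s_comm : ∀ i j : Fin (d - 1), i.val + 1 < j.val ∨ j.val + 1 < i.val → s i * s j = s j * s i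
  x_s : ∀ (j : Fin d) (i : Fin (d - 1)), j.val ≠ i.val → j.val ≠ i.val + 1 →
    x j * s i = s i * x j
  mixed : ∀ (i : Fin (d - 1)) (j k : Fin d), j.val = i.val → k.val = i.val + 1 →
    x k * s i - s i * x j = 1
  x_comm : ∀ i j, x i * x j = x j * x i

/-- The relations of the degenerate affine Hecke algebra in the free algebra on `x_i`, `s_i`. -/
inductive DAHARel (d : ℕ) :
    FreeAlgebra ℂ (Fin d ⊕ Fin (d - 1)) → FreeAlgebra ℂ (Fin d ⊕ Fin (d - 1)) → Prop
  | s_sq (i : Fin (d - 1)) : DAHARel d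
      (FreeAlgebra.ι ℂ (Sum.inr i) * FreeAlgebra.ι ℂ (Sum.inr i)) 1
  | braid (i j : Fin (d - 1)) (h : i.val + 1 = j.val) : DAHARel d
      (FreeAlgebra.ι ℂ (Sum.inr i) * FreeAlgebra.ι ℂ (Sum.inr j) * FreeAlgebra.ι ℂ (Sum.inr i))
      (FreeAlgebra.ι ℂ (Sum.inr j) * FreeAlgebra.ι ℂ (Sum.inr i) * FreeAlgebra.ι ℂ (Sum.inr j))
  | s_comm (i j : Fin (d - 1)) (h : i.val + 1 < j.val ∨ j.val + 1 < i.val) : DAHARel d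
      (FreeAlgebra.ι ℂ (Sum.inr i) * FreeAlgebra.ι ℂ (Sum.inr j))
      (FreeAlgebra.ι ℂ (Sum.inr j) * FreeAlgebra.ι ℂ (Sum.inr i))
  | x_s (j : Fin d) (i : Fin (d - 1)) (h : j.val ≠ i.val) (h' : j.val ≠ i.val + 1) : DAHARel d
      (FreeAlgebra.ι ℂ (Sum.inl j) * FreeAlgebra.ι ℂ (Sum.inr i))
      (FreeAlgebra.ι ℂ (Sum.inr i) * FreeAlgebra.ι ℂ (Sum.inl j))
  | mixed (i : Fin (d - 1)) (j k : Fin d) (h : j.val = i.val) (h' : k.val = i.val + 1) : DAHARel d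
      (FreeAlgebra.ι ℂ (Sum.inl k) * FreeAlgebra.ι ℂ (Sum.inr i)
        - FreeAlgebra.ι ℂ (Sum.inr i) * FreeAlgebra.ι ℂ (Sum.inl j)) 1
  | x_comm (i j : Fin d) : DAHARel d
      (FreeAlgebra.ι ℂ (Sum.inl i) * FreeAlgebra.ι ℂ (Sum.inl j))
      (FreeAlgebra.ι ℂ (Sum.inl j) * FreeAlgebra.ι ℂ (Sum.inl i))

/-- The degenerate affine Hecke algebra `H_d`. -/
abbrev DAHA (d : ℕ) : Type := RingQuot (DAHARel d)

/-- The generator `x_i` of `H_d`. -/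
def DAHA.x {d : ℕ} (i : Fin d) : DAHA d :=
  RingQuot.mkAlgHom ℂ (DAHARel d) (FreeAlgebra.ι ℂ (Sum.inl i))

/-- The generator `s_i` of `H_d`. -/
def DAHA.s {d : ℕ} (i : Fin (d - 1)) : DAHA d :=
  RingQuot.mkAlgHom ℂ (DAHARel d) (FreeAlgebra.ι ℂ (Sum.inr i))

end PrincipalW

end

/-! Call a `U(𝔤)`-module a Whittaker module if `x - χ(x)` acts locally nilpotently for every matrix
unit `x ∈ 𝔪`. The core of the proof is Skryabin's equivalence: for such `L` the counit `Q_χ ⊗ Wh(L)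
→ L` is bijective (`counit_bijective`). Modules generated by Whittaker vectors are Whittaker
modules, so `Q_χ ⊗ M` is one, and tensoring with `V` preserves the property. Hence the counit at
`(Q_χ ⊗ M) ⊗ V` is invertible. Since `α` is `Wh` applied to this counit tensored with `V`, followed
by the associator, `α` is invertible.

For the equivalence, the basis of `𝔪` is enumerated by rows in order of decreasing column, with
`e_{l, pred l}` first in row `l`. The vector `x = e_{lk}` is paired with `u = e_{k, pred l}`, and
`[x, u] = e_{l, pred l}`. On vectors satisfying all conditions before `x`, this bracket is the
scalar `χ(e_{l, pred l}) = ±1`, except that for `k = pred l` it is `x` itself. So `x - χ(x)` and `u`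
satisfy a Weyl-type relation for even `x` and a Clifford relation for odd `x`. Consequently the
vectors of one stage are sums of fixed polynomials in `u` applied to vectors of the next stage, with
unique coefficients. Existence (`whUpTo_le_iSup`) shows that Whittaker vectors generate the module.
Uniqueness (`mem_of_mem_iSup_stepFamily`) shows that the Whittaker vectors of `Q_χ ⊗ M` are the `1_χ
⊗ v`. The counit sends `1_χ ⊗ v` to `v`, so its kernel contains no nonzero Whittaker vector and
vanishes by an Engel-type argument.

For the Hecke relations, the counits identify `Q_χ ⊗ (M ⊛ V ⊛ ⋯ ⊛ V)` with `(Q_χ ⊗ M) ⊗ V ⊗ ⋯ ⊗ V`,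
turning `x` into `Ω` and `s` into the superflip of two factors `V`. There the braid relation is a
computation with signs, and the mixed relation (`omega_flipV`) holds because `Ω` on `(L ⊗ V) ⊗ V` is
`Ω^{[1,3]} + Ω^{[2,3]}`, the second term being the flip. The relations descend because `Q_χ ⊗ -` is
faithful on maps into spaces of Whittaker vectors. The commutation relations are naturality, and
induction on `d` gives the general case. -/

noncomputable section

namespace PrincipalW

/-! ### Divided powers for Weyl-type relations -/

section Weyl

variable {E : Type*} [AddCommGroup E] [Module ℂ E]

/-- A family lowered by an operator `y` which is locally nilpotent on `S` lets `ker y ∩ S`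
generate `S`. -/
lemma le_iSup_map_of_lowering {S D : Submodule ℂ E} (y : Module.End ℂ E) (b : ℕ → Module.End ℂ E)
    (hy : ∀ v ∈ S, ∃ k : ℕ, (y ^ k) v = 0) (hyS : ∀ v ∈ S, y v ∈ S)
    (hD : ∀ v ∈ S, y v = 0 → v ∈ D) (hbS : ∀ a, ∀ d ∈ D, b a d ∈ S)
    (hb : ∀ a, ∀ d ∈ D, y (b (a + 1) d) = b a d) (hb0 : ∀ d ∈ D, b 0 d = d) :
    S ≤ ⨆ a, D.map (b a) := by
  -- Raising the index of every term gives a preimage under `y`, so `y` maps the part of the sum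
  -- lying in `S` onto the whole sum.
  have hlift : ∀ z ∈ ⨆ a, D.map (b a), ∃ w ∈ ⨆ a, D.map (b a), w ∈ S ∧ y w = z := by
    intro z hz
    induction hz using Submodule.iSup_induction' with
    | mem a z hz =>
      obtain ⟨d, hd, rfl⟩ := hz
      exact ⟨b (a + 1) d, Submodule.mem_iSup_of_mem (a + 1) ⟨d, hd, rfl⟩, hbS _ d hd, hb a d hd⟩
    | zero => exact ⟨0, zero_mem _, zero_mem _, map_zero _⟩
    | add z z' _ _ h h' =>
      obtain ⟨w, h1, h2, rfl⟩ := h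
      obtain ⟨w', h1', h2', rfl⟩ := h'
      exact ⟨w + w', add_mem h1 h1', add_mem h2 h2', map_add _ _ _⟩
  have main : ∀ (k : ℕ), ∀ v ∈ S, (y ^ k) v = 0 → v ∈ ⨆ a, D.map (b a) := by
    intro k
    induction k with
    | zero => intro v _ h; rw [pow_zero, Module.End.one_apply] at h; rw [h]; exact zero_mem _
    | succ k ih =>
      intro v hv h
      rw [pow_succ, Module.End.mul_apply] at h
      -- By induction `y v` lies in the sum; correcting `v` by a preimage `w` of `y v` leaves an
      -- element of `ker y ∩ S ⊆ D`.
      obtain ⟨w, hw, hwS, hwy⟩ := hlift _ (ih _ (hyS v hv) h)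
      have h0 : v - w ∈ D := hD _ (sub_mem hv hwS) (by rw [map_sub, hwy, sub_self])
      have h1 : v - w ∈ ⨆ a, D.map (b a) :=
        Submodule.mem_iSup_of_mem 0 ⟨v - w, h0, hb0 _ h0⟩
      simpa using add_mem h1 hw
  intro v hv
  obtain ⟨k, hk⟩ := hy v hv
  exact main k v hv hk

/-- Since `y` lowers the index by one and kills the term of index `0`, applying it repeatedly shows
that an expansion `∑ b_a d_a` with `d_a ∈ D` has unique coefficients. If `y` kills the sum, every
coefficient of positive index vanishes and only `b_0 d_0 = d_0` remains. -/
lemma mem_of_mem_iSup_map_of_lowering {D : Submodule ℂ E} (y : Module.End ℂ E)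
    (b : ℕ → Module.End ℂ E) (hb : ∀ a, ∀ d ∈ D, y (b (a + 1) d) = b a d)
    (hb0 : ∀ d ∈ D, b 0 d = d) (hD : ∀ d ∈ D, y d = 0) {z : E} (hz : z ∈ ⨆ a, D.map (b a))
    (hyz : y z = 0) : z ∈ D := by
  have hy : ∀ (k : ℕ) (d : ℕ → E), (∀ a, d a ∈ D) →
      y (∑ a ∈ Finset.range (k + 1), b a (d a)) = ∑ a ∈ Finset.range k, b a (d (a + 1)) := by
    intro k d hd
    rw [Finset.sum_range_succ', map_add, map_sum, hb0 _ (hd 0), hD _ (hd 0), add_zero]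
    exact Finset.sum_congr rfl fun a _ => hb a _ (hd _)
  have indep : ∀ (k : ℕ) (d : ℕ → E), (∀ a, d a ∈ D) →
      ∑ a ∈ Finset.range k, b a (d a) = 0 → ∀ a < k, d a = 0 := by
    intro k
    induction k with
    | zero => intro d _ _ a ha; omega
    | succ k ih =>
      intro d hd h
      have h1 := ih (fun a => d (a + 1)) (fun a => hd _) (by rw [← hy k d hd, h, map_zero])
      intro a ha
      rcases a with _ | a
      · rw [Finset.sum_range_succ', Finset.sum_eq_zero, zero_add, hb0 _ (hd 0)] at h
        · exact h
        · intro a ha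
          rw [h1 a (Finset.mem_range.1 ha), map_zero]
      · exact h1 a (by omega)
  obtain ⟨f, hf, rfl⟩ := (Submodule.mem_iSup_iff_exists_finsupp _ _).1 hz
  choose d hdD hd using hf
  obtain ⟨k, hk⟩ : ∃ k, f.support ⊆ Finset.range (k + 1) := by
    refine ⟨f.support.sup id, fun a ha => Finset.mem_range.2 ?_⟩
    have := Finset.le_sup (f := id) ha
    simp only [id] at this
    omega
  have hsum : (f.sum fun _ x => x) = ∑ a ∈ Finset.range (k + 1), b a (d a) := by
    rw [Finsupp.sum_of_support_subset _ hk _ (by simp)]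
    exact Finset.sum_congr rfl fun a _ => (hd a).symm
  rw [hsum] at hyz ⊢
  rw [hy k d hdD] at hyz
  have h1 := indep k (fun a => d (a + 1)) (fun a => hdD _) hyz
  rw [Finset.sum_range_succ', Finset.sum_eq_zero, zero_add, hb0 _ (hdD 0)]
  · exact hdD 0
  · intro a ha
    rw [h1 a (Finset.mem_range.1 ha), map_zero]

/-- The divided power type elements `b_a` with `b_0 = 1` and
`b_{a+1} = (u - a δ) b_a / (c (a + 1))`. -/
def divPow {B : Type*} [Ring B] [Algebra ℂ B] (u : B) (c δ : ℂ) : ℕ → B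
  | 0 => 1
  | a + 1 => (c * (a + 1))⁻¹ • ((u - algebraMap ℂ B (a * δ)) * divPow u c δ a)

lemma map_divPow {B B' : Type*} [Ring B] [Algebra ℂ B] [Ring B'] [Algebra ℂ B'] (f : B →ₐ[ℂ] B')
    (u : B) (c δ : ℂ) (a : ℕ) : f (divPow u c δ a) = divPow (f u) c δ a := by
  induction a with
  | zero => simp [divPow]
  | succ a ih =>
    rw [divPow, divPow, map_smul, map_mul, ih, map_sub, AlgHom.commutes]

lemma divPow_mem {S : Submodule ℂ E} {u : Module.End ℂ E} (hu : ∀ v ∈ S, u v ∈ S) (c δ : ℂ)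
    (a : ℕ) {v : E} (hv : v ∈ S) : divPow u c δ a v ∈ S := by
  induction a with
  | zero => exact hv
  | succ a ih =>
    rw [divPow, LinearMap.smul_apply, Module.End.mul_apply, LinearMap.sub_apply,
      Module.algebraMap_end_apply]
    exact S.smul_mem _ (sub_mem (hu _ ih) (S.smul_mem _ ih))

/-- On `S` the commutator is `[y, u] = c + δ y`. The term `δ y` shifts `u` by `δ` whenever `y`
passes it, which is why the factors are `u - a δ` and not `u`. Inductively, `y (u - a δ) b_a d = (u
- (a - 1) δ) b_{a-1} d + c b_a d = c (a + 1) b_a d` for `a > 0`. For `δ = 0` one recovers the usual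
divided powers of `u / c`. -/
lemma lower_divPow {S : Submodule ℂ E} {y u : Module.End ℂ E} {c δ : ℂ} (hc : c ≠ 0)
    (hu : ∀ v ∈ S, u v ∈ S) (hyu : ∀ v ∈ S, y (u v) = u (y v) + c • v + δ • y v)
    {d : E} (hd : d ∈ S) (hyd : y d = 0) (a : ℕ) :
    y (divPow u c δ (a + 1) d) = divPow u c δ a d := by
  induction a with
  | zero =>
    simp only [divPow, LinearMap.smul_apply, Module.End.mul_apply, LinearMap.sub_apply,
      Module.algebraMap_end_apply, Module.End.one_apply, map_smul, map_sub]
    rw [hyu d hd, hyd]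
    simp [hc]
  | succ a ih =>
    rw [divPow, LinearMap.smul_apply, Module.End.mul_apply, LinearMap.sub_apply,
      Module.algebraMap_end_apply, map_smul, map_sub, map_smul,
      hyu _ (divPow_mem hu c δ (a + 1) hd), ih]
    have h1 : u (divPow u c δ a d)
        = (c * (a + 1)) • divPow u c δ (a + 1) d + (a * δ) • divPow u c δ a d := by
      rw [divPow, LinearMap.smul_apply, smul_smul, mul_inv_cancel₀, one_smul,
        Module.End.mul_apply, LinearMap.sub_apply, Module.algebraMap_end_apply, sub_add_cancel]
      exact mul_ne_zero hc (by exact_mod_cast Nat.succ_ne_zero a)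
    have h2 : (c * ((a + 1 : ℕ) + 1)) ≠ 0 :=
      mul_ne_zero hc (by exact_mod_cast Nat.succ_ne_zero (a + 1))
    rw [h1, inv_smul_eq_iff₀ h2]
    push_cast
    module

/-- The vectors killed by a power of `y` are stable under `z` if they are under `[y, z]`. -/
lemma locNil_of_commutator {y z w : Module.End ℂ E} (h : ∀ v, y (z v) = z (y v) + w v)
    (hw : ∀ v, (∃ k : ℕ, (y ^ k) v = 0) → ∃ k : ℕ, (y ^ k) (w v) = 0) {v : E}
    (hv : ∃ k : ℕ, (y ^ k) v = 0) : ∃ k : ℕ, (y ^ k) (z v) = 0 := by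
  obtain ⟨k, hk⟩ := hv
  induction k generalizing v with
  | zero =>
    rw [pow_zero, Module.End.one_apply] at hk
    exact ⟨0, by rw [hk, map_zero, map_zero]⟩
  | succ k ih =>
    obtain ⟨p, hp⟩ := ih (v := y v) (by rwa [pow_succ, Module.End.mul_apply] at hk)
    obtain ⟨q, hq⟩ := hw v ⟨k + 1, hk⟩
    refine ⟨p + q + 1, ?_⟩
    rw [pow_succ, Module.End.mul_apply, h, map_add,
      Module.End.pow_map_zero_of_le (Nat.le_add_right p q) hp,
      Module.End.pow_map_zero_of_le (Nat.le_add_left q p) hq, add_zero]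

lemma locNil_add {y : Module.End ℂ E} {v w : E} (hv : ∃ k : ℕ, (y ^ k) v = 0)
    (hw : ∃ k : ℕ, (y ^ k) w = 0) : ∃ k : ℕ, (y ^ k) (v + w) = 0 := by
  obtain ⟨p, hp⟩ := hv
  obtain ⟨q, hq⟩ := hw
  refine ⟨p + q, ?_⟩
  rw [map_add, Module.End.pow_map_zero_of_le (Nat.le_add_right p q) hp,
    Module.End.pow_map_zero_of_le (Nat.le_add_left q p) hq, add_zero]

end Weyl

/-! ### The order on the basis of `𝔪` -/

variable {m n : ℕ}

/-- The index in the same row and the previous column. -/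
def pred : I m n → I m n
  | Sum.inl i => Sum.inl ⟨i - 1, by omega⟩
  | Sum.inr j => Sum.inr ⟨j - 1, by omega⟩

/-- The subtraction is truncated: `pred` fixes the indices of column `0`. In the arguments below a
strict inequality of columns keeps `l` away from that column. -/
lemma col_pred (i : I m n) : col (pred i) = col i - 1 := by cases i <;> rfl

lemma par_pred (i : I m n) : par (pred i) = par i := by cases i <;> rfl

lemma ext_col_par {i j : I m n} (h : col i = col j) (h' : par i = par j) : i = j := by
  cases i <;> cases j <;> simp_all [col, par, Fin.ext_iff]

lemma col_lt (i : I m n) : col i < m + n := by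
  cases i <;> simp only [col] <;> omega

lemma par_le (i : I m n) : par i ≤ 1 := by rcases par_cases i with h | h <;> omega

/-- On the basis of `𝔪`, `χ` is supported on the vectors `e_{i, pred i}`. Its value there being
nonzero makes the pairing of `e_{lk}` with `e_{k, pred l}` nondegenerate. -/
lemma chi_pred {i : I m n} (h : 0 < col i) : chi i (pred i) = (-1 : ℂ) ^ par i := by
  rw [chi_eq, par_pred]
  cases i <;> simp only [col] at h <;> simp [pred, nilp] <;> omega

lemma chi_eq_zero {i j : I m n} (h : col j < col i) (h' : j ≠ pred i) : chi i j = 0 := by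
  rw [chi_eq, mul_eq_zero]
  right
  cases i <;> cases j <;> simp only [col] at h <;> simp only [nilp]
  all_goals
    rw [if_neg]
    rintro h1
    refine h' ?_
    simp only [pred]
    congr 1
    ext
    simp only
    omega

/-- `χ` vanishes on odd matrix units, so the sign acquired in moving `e_{ij}` past another element
disappears after multiplication by `χ(e_{ij})`. -/
lemma chi_pow (i j : I m n) (q : ℕ) : (-1 : ℂ) ^ (epar i j * q) * chi i j = chi i j := by
  rw [pow_mul]
  induction q with
  | zero => simp
  | succ q ih => rw [pow_succ, mul_assoc, chi_parity, ih]

/-- The position of the row `i` in the enumeration of the basis of `𝔪`. -/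
def rowKey (i : I m n) : ℕ := 2 * (m + n - col i) + par i

/-- The position of `e_{ij}` in the enumeration of the basis of `𝔪`. -/
def rank (i j : I m n) : ℕ :=
  rowKey i * (2 * (m + n) + 1) + if j = pred i then 0 else 2 * col j + par j + 1

/-- `rank` is a two-digit number in base `2 (m + n) + 1`: the leading digit encodes the row and the
last digit, at most `2 (m + n)`, the place in the row. The last digit `0` is reserved for `j = pred
i`. -/
lemma rank_div (i j : I m n) : rank i j / (2 * (m + n) + 1) = rowKey i := by
  have h1 := col_lt j
  have h2 := par_le j
  rw [rank, add_comm, Nat.add_mul_div_right _ _ (by omega), Nat.div_eq_of_lt, zero_add]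
  split_ifs <;> omega

lemma rowKey_le {i j k l : I m n} (h : rank i j ≤ rank k l) : rowKey i ≤ rowKey k := by
  rw [← rank_div i j, ← rank_div k l]
  exact Nat.div_le_div_right h

lemma rowKey_inj {i k : I m n} (h : rowKey i = rowKey k) : i = k := by
  have h1 := col_lt i
  have h2 := par_le i
  have h3 := col_lt k
  have h4 := par_le k
  unfold rowKey at h
  exact ext_col_par (by omega) (by omega)

lemma col_le_of_rank {i j k l : I m n} (h : rank i j ≤ rank k l) : col k ≤ col i := by
  have h1 := col_lt i
  have h2 := par_le i
  have h3 := col_lt k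
  have h4 := par_le k
  have := rowKey_le h
  unfold rowKey at this
  omega

/-- The order is by rows first, so an earlier row precedes `e_{kl}` as a whole. This allows a
bracket in row `i` to be evaluated by a Whittaker condition that is already known. -/
lemma rank_lt {i j k l : I m n} (h : rank i j ≤ rank k l) (hik : i ≠ k) (j' : I m n) :
    rank i j' < rank k l := by
  by_contra! h'
  exact hik (rowKey_inj (le_antisymm (rowKey_le h) (rowKey_le h')))

lemma rank_inj {i j k l : I m n} (h : rank i j = rank k l) : i = k ∧ j = l := by
  have h1 : i = k := rowKey_inj (le_antisymm (rowKey_le h.le) (rowKey_le h.ge))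
  subst h1
  refine ⟨rfl, ?_⟩
  have h2 := par_le j
  have h4 := par_le l
  unfold rank at h
  split_ifs at h with h5 h6 h6
  · rw [h5, h6]
  · omega
  · omega
  · exact ext_col_par (by omega) (by omega)

lemma rank_pred_le (i j : I m n) : rank i (pred i) ≤ rank i j := by
  simp [rank]

lemma rank_lt_bound (i j : I m n) : rank i j < (2 * (m + n) + 2) * (2 * (m + n) + 1) := by
  rw [← Nat.div_lt_iff_lt_mul (by omega), rank_div]
  have := par_le i
  unfold rowKey
  omega

/-! ### Partial Whittaker vectors -/

section Partial

variable {E : Type*} [AddCommGroup E] [Module ℂ E] (ρ : U m n →ₐ[ℂ] Module.End ℂ E)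

/-- Vectors satisfying the Whittaker condition for the first `t` basis elements of `𝔪`. -/
def whUpTo (t : ℕ) : Submodule ℂ E where
  carrier := {v | ∀ i j : I m n, col j < col i → rank i j < t → ρ (e i j) v = chi i j • v}
  add_mem' {v w} hv hw i j h h' := by rw [map_add, hv i j h h', hw i j h h', smul_add]
  zero_mem' i j _ _ := by simp
  smul_mem' c v hv i j h h' := by rw [map_smul, hv i j h h', smul_comm]

/-- The operator `x - χ(x)` for `x = e_{ij}`. -/
def shifted (i j : I m n) : Module.End ℂ E := ρ (e i j) - algebraMap ℂ _ (chi i j)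

lemma shifted_apply (i j : I m n) (v : E) : shifted ρ i j v = ρ (e i j) v - chi i j • v := by
  rw [shifted, LinearMap.sub_apply, Module.algebraMap_end_apply]

lemma whUpTo_zero : whUpTo ρ 0 = ⊤ := by
  rw [eq_top_iff]
  intro v _ i j _ h
  omega

lemma whUpTo_succ_le (t : ℕ) : whUpTo ρ (t + 1) ≤ whUpTo ρ t :=
  fun _ hv i j h h' => hv i j h (by omega)

lemma mem_whUpTo_succ {l k : I m n} {v : E} (hv : v ∈ whUpTo ρ (rank l k))
    (h : ρ (e l k) v = chi l k • v) : v ∈ whUpTo ρ (rank l k + 1) := by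
  intro i j hij hr
  rcases Nat.lt_succ_iff_lt_or_eq.1 hr with hr | hr
  · exact hv i j hij hr
  · obtain ⟨rfl, rfl⟩ := rank_inj hr
    exact h

lemma whUpTo_succ_of_forall_ne {t : ℕ} (h : ∀ l k : I m n, col k < col l → rank l k ≠ t) :
    whUpTo ρ (t + 1) = whUpTo ρ t := by
  refine le_antisymm (whUpTo_succ_le ρ t) fun v hv i j hij hr => hv i j hij ?_
  have := h i j hij
  omega

lemma ρ_e_comm (i j k l : I m n) (v : E) :
    ρ (e i j) (ρ (e k l) v) = (-1 : ℂ) ^ (epar i j * epar k l) • ρ (e k l) (ρ (e i j) v)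
      + ((if j = k then ρ (e i l) v else 0)
        - (-1 : ℂ) ^ (epar i j * epar k l) • (if i = l then ρ (e k j) v else 0)) := by
  have h := congrArg (fun a => ρ a v) (e_comm i j k l)
  simp only [map_sub, map_mul, map_smul, LinearMap.sub_apply, LinearMap.smul_apply,
    Module.End.mul_apply] at h
  rw [← sub_eq_iff_eq_add', h]
  split_ifs <;> simp

lemma ρ_e_whUpTo {i j a b : I m n} {v : E} (hv : ρ (e i j) v = chi i j • v) (hib : i ≠ b) :
    ρ (e i j) (ρ (e a b) v)
      = chi i j • ρ (e a b) v + (if j = a then ρ (e i b) v else 0) := by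
  rw [ρ_e_comm, hv, map_smul, smul_smul, chi_pow, if_neg hib, smul_zero, sub_zero]

/-- Moving an earlier `e_{ij}` past `e_{lk}` produces at most `e_{ik}`, when `j = l`. Its row
precedes row `l`, so it acts by `χ(e_{ik})`, which is `0` because `k` is at least two columns to the
left of `i`. -/
lemma x_mem_whUpTo {l k : I m n} (hkl : col k < col l) {v : E}
    (hv : v ∈ whUpTo ρ (rank l k)) : ρ (e l k) v ∈ whUpTo ρ (rank l k) := by
  intro i j hij hr
  have hc := col_le_of_rank hr.le
  rw [ρ_e_whUpTo ρ (hv i j hij hr) (by rintro rfl; omega), add_eq_left]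
  split_ifs with h
  · subst h
    rw [hv i k (by omega) (rank_lt hr.le (by rintro rfl; omega) k), chi_eq_zero (by omega),
      zero_smul]
    intro h
    have := col_pred i
    rw [← h] at this
    omega
  · rfl

lemma shifted_mem_whUpTo {l k : I m n} (hkl : col k < col l) {v : E}
    (hv : v ∈ whUpTo ρ (rank l k)) : shifted ρ l k v ∈ whUpTo ρ (rank l k) := by
  rw [shifted_apply]
  exact sub_mem (x_mem_whUpTo ρ hkl hv) (Submodule.smul_mem _ _ hv)

/-- Moving an earlier `e_{ij}` past `e_{k, pred l}` produces at most `e_{i, pred l}`, when `j = k`.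
Then `i ≠ l`, so its row is an earlier one, and `χ` vanishes on it because `pred i = pred l` would
force `i = l`. -/
lemma u_mem_whUpTo {l k : I m n} (hkl : col k < col l) {v : E}
    (hv : v ∈ whUpTo ρ (rank l k)) : ρ (e k (pred l)) v ∈ whUpTo ρ (rank l k) := by
  intro i j hij hr
  have hc := col_le_of_rank hr.le
  have hp := col_pred l
  rw [ρ_e_whUpTo ρ (hv i j hij hr) (by rintro rfl; omega), add_eq_left]
  split_ifs with h
  · subst h
    have hil : i ≠ l := by rintro rfl; omega
    rw [hv i (pred l) (by omega) (rank_lt hr.le hil _), chi_eq_zero (by omega), zero_smul]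
    intro h
    refine hil (ext_col_par ?_ ?_)
    · have := col_pred i
      rw [← h] at this
      omega
    · rw [← par_pred i, ← h, par_pred]
  · rfl

/-- The elements of `U(𝔤)` generating the vectors satisfying the Whittaker condition up to
`e_{lk}` from those satisfying it for `e_{lk}` too. -/
def stepFamily (l k : I m n) (a : ℕ) : U m n :=
  if par l = par k then
    divPow (e k (pred l)) ((-1) ^ par l) (if k = pred l then 1 else 0) a
  else if a = 0 then 1 else if a = 1 then e k (pred l) else 0

lemma ne_pred_of_par_ne {l k : I m n} (h : par l ≠ par k) : k ≠ pred l := by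
  rintro rfl
  exact h (par_pred l).symm

/-- The bracket is `e_{l, pred l}`. If `k ≠ pred l` it precedes `e_{lk}` in the enumeration and acts
by the scalar `χ`; this is why `e_{l, pred l}` comes first in its row. If `k = pred l` it is
`e_{lk}` itself, that is, `χ` plus the shifted operator, whence the extra term. -/
lemma shifted_u_even {l k : I m n} (hkl : col k < col l) (hp : par l = par k) {v : E}
    (hv : v ∈ whUpTo ρ (rank l k)) :
    shifted ρ l k (ρ (e k (pred l)) v) = ρ (e k (pred l)) (shifted ρ l k v)
      + (-1 : ℂ) ^ par l • v + (if k = pred l then (1 : ℂ) else 0) • shifted ρ l k v := by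
  have hp' : epar l k * epar k (pred l) = 4 * (par l * par l) := by
    rw [epar, epar, par_pred, hp]; ring
  have hl : l ≠ pred l := by
    intro h
    have := col_pred l
    rw [← h] at this
    omega
  rw [shifted_apply, shifted_apply, ρ_e_comm, hp', if_pos rfl, if_neg hl, pow_mul, map_sub,
    map_smul]
  by_cases h : k = pred l
  · subst h
    rw [chi_pred (by omega)]
    norm_num
    module
  · rw [if_neg h, hv l (pred l) (by rw [col_pred]; omega)
      (lt_of_le_of_ne (rank_pred_le l k) fun h' => h (rank_inj h').2.symm), chi_pred (by omega)]
    norm_num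
    module

lemma eq_zero_of_self_eq_neg {v : E} (h : v = -v) : v = 0 := by
  have h2 : (2 : ℂ) • v = 0 := by rw [two_smul, ← eq_neg_iff_add_eq_zero]; exact h
  exact (smul_eq_zero.1 h2).resolve_left two_ne_zero

lemma x_x_odd {l k : I m n} (hp : par l ≠ par k) (v : E) :
    ρ (e l k) (ρ (e l k) v) = 0 := by
  have h := ρ_e_comm ρ l k l k v
  have h1 : epar l k * epar l k = 1 := by
    have : epar l k = 1 := by
      rw [epar]
      rcases par_cases l with h | h <;> rcases par_cases k with h' | h' <;> omega
    rw [this]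
  have hlk : l ≠ k := by rintro rfl; exact hp rfl
  rw [h1, if_neg hlk, if_neg hlk.symm] at h
  simp only [pow_one, neg_smul, one_smul, smul_zero, sub_zero, add_zero] at h
  exact eq_zero_of_self_eq_neg h

/-- For odd `e_{lk}` the indices `l` and `k` have different parities, so `k ≠ pred l` and `e_{l,
pred l}` acts by its scalar. Together with `x_x_odd` this gives the Clifford relations that replace
the Weyl relation of the even case. -/
lemma x_u_odd {l k : I m n} (hkl : col k < col l) (hp : par l ≠ par k) {v : E}
    (hv : v ∈ whUpTo ρ (rank l k)) :
    ρ (e l k) (ρ (e k (pred l)) v) = - ρ (e k (pred l)) (ρ (e l k) v) + (-1 : ℂ) ^ par l • v := by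
  have hp' : epar l k * epar k (pred l) = 1 := by
    rw [epar, epar, par_pred]
    rcases par_cases l with h | h <;> rcases par_cases k with h' | h' <;> simp_all
  have hl : l ≠ pred l := by
    intro h
    have := col_pred l
    rw [← h] at this
    omega
  rw [ρ_e_comm, hp', if_pos rfl, if_neg hl, hv l (pred l) (by rw [col_pred]; omega)
      (lt_of_le_of_ne (rank_pred_le l k) fun h' => ne_pred_of_par_ne hp (rank_inj h').2.symm),
      chi_pred (by omega)]
  simp

/-- The module is a Whittaker module: `x - χ(x)` is locally nilpotent for the `x ∈ 𝔪`. -/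
def IsWhittaker : Prop :=
  ∀ i j : I m n, col j < col i → ∀ v, ∃ k : ℕ, (shifted ρ i j ^ k) v = 0

lemma shifted_eq_zero_iff {l k : I m n} {v : E} (hv : v ∈ whUpTo ρ (rank l k))
    (h : shifted ρ l k v = 0) : v ∈ whUpTo ρ (rank l k + 1) :=
  mem_whUpTo_succ ρ hv (by rwa [shifted_apply, sub_eq_zero] at h)

lemma shifted_of_mem {l k : I m n} (hkl : col k < col l) {v : E}
    (hv : v ∈ whUpTo ρ (rank l k + 1)) : shifted ρ l k v = 0 := by
  rw [shifted_apply, sub_eq_zero]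
  exact hv l k hkl (by omega)

/-- Existence of the expansion in powers of `u`. Local nilpotency makes it finite in the even case;
in the odd case only `1` and `u` occur. -/
lemma whUpTo_le_iSup (hρ : IsWhittaker ρ) {l k : I m n} (hkl : col k < col l) :
    whUpTo ρ (rank l k)
      ≤ ⨆ a, (whUpTo ρ (rank l k + 1)).map (ρ (stepFamily l k a)) := by
  have hle := whUpTo_succ_le ρ (rank l k)
  by_cases hp : par l = par k
  · simp only [stepFamily, if_pos hp, map_divPow]
    have hu := fun v (hv : v ∈ whUpTo ρ (rank l k)) => u_mem_whUpTo ρ hkl hv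
    refine le_iSup_map_of_lowering (shifted ρ l k) _ (fun v _ => hρ l k hkl v)
      (fun v hv => shifted_mem_whUpTo ρ hkl hv) (fun v hv h => shifted_eq_zero_iff ρ hv h)
      (fun a d hd => divPow_mem hu _ _ a (hle hd)) (fun a d hd => ?_) (fun d _ => rfl)
    exact lower_divPow (by simp) hu (fun v hv => shifted_u_even ρ hkl hp hv) (hle hd)
      (shifted_of_mem ρ hkl hd) a
  · intro v hv
    have h0 : ∀ w ∈ whUpTo ρ (rank l k), ρ (e l k) w = 0 → w ∈ whUpTo ρ (rank l k + 1) := by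
      intro w hw h
      exact mem_whUpTo_succ ρ hw (by rw [h, chi_eq_zero hkl (ne_pred_of_par_ne hp), zero_smul])
    have h1 : ρ (e l k) v ∈ whUpTo ρ (rank l k + 1) :=
      h0 _ (x_mem_whUpTo ρ hkl hv) (x_x_odd ρ hp v)
    have h2 : ρ (e l k) (ρ (e k (pred l)) v) ∈ whUpTo ρ (rank l k + 1) :=
      h0 _ (x_mem_whUpTo ρ hkl (u_mem_whUpTo ρ hkl hv)) (x_x_odd ρ hp _)
    -- The relation `x u + u x = ±1` writes `v` as `±(x u v + u x v)`, and both `x u v` and `x v`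
    -- are killed by `x` because `x² = 0`.
    have h3 : v = (-1 : ℂ) ^ par l • (ρ (stepFamily l k 0) (ρ (e l k) (ρ (e k (pred l)) v))
        + ρ (stepFamily l k 1) (ρ (e l k) v)) := by
      simp only [stepFamily, if_neg hp, if_true, map_one, Module.End.one_apply, one_ne_zero,
        if_false]
      rw [x_u_odd ρ hkl hp hv, add_comm, add_neg_cancel_left, smul_smul, neg_one_pow_sq, one_smul]
    rw [h3]
    exact Submodule.smul_mem _ _ (add_mem (Submodule.mem_iSup_of_mem 0 ⟨_, h2, rfl⟩)
      (Submodule.mem_iSup_of_mem 1 ⟨_, h1, rfl⟩))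

/-- Uniqueness of the expansion. Allowing an arbitrary subspace `D` of the next stage is essential:
it shows that a subspace generating enough vectors of one stage already contains the corresponding
vectors of the next. -/
lemma mem_of_mem_iSup_stepFamily {l k : I m n} (hkl : col k < col l) {D : Submodule ℂ E}
    (hD : D ≤ whUpTo ρ (rank l k + 1)) {z : E} (hz : z ∈ ⨆ a, D.map (ρ (stepFamily l k a)))
    (hz' : z ∈ whUpTo ρ (rank l k + 1)) : z ∈ D := by
  have hle := whUpTo_succ_le ρ (rank l k)
  by_cases hp : par l = par k
  · simp only [stepFamily, if_pos hp, map_divPow] at hz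
    have hu := fun v (hv : v ∈ whUpTo ρ (rank l k)) => u_mem_whUpTo ρ hkl hv
    refine mem_of_mem_iSup_map_of_lowering (shifted ρ l k) _ (fun a d hd => ?_) (fun d _ => rfl)
      (fun d hd => shifted_of_mem ρ hkl (hD hd)) hz (shifted_of_mem ρ hkl hz')
    exact lower_divPow (by simp) hu (fun v hv => shifted_u_even ρ hkl hp hv) (hle (hD hd))
      (shifted_of_mem ρ hkl (hD hd)) a
  · have h1 : ∃ d ∈ D, ∃ d' ∈ D, z = d + ρ (e k (pred l)) d' := by
      clear hz'
      induction hz using Submodule.iSup_induction' with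
      | mem a z hz =>
        obtain ⟨d, hd, rfl⟩ := hz
        simp only [stepFamily, if_neg hp]
        split_ifs
        · exact ⟨d, hd, 0, zero_mem _, by simp⟩
        · exact ⟨0, zero_mem _, d, hd, by simp⟩
        · exact ⟨0, zero_mem _, 0, zero_mem _, by simp⟩
      | zero => exact ⟨0, zero_mem _, 0, zero_mem _, by simp⟩
      | add z w _ _ h h' =>
        obtain ⟨d, hd, c, hc, rfl⟩ := h
        obtain ⟨d', hd', c', hc', rfl⟩ := h'
        exact ⟨d + d', add_mem hd hd', c + c', add_mem hc hc', by rw [map_add]; abel⟩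
    have hx : ∀ w ∈ whUpTo ρ (rank l k + 1), ρ (e l k) w = 0 := by
      intro w hw
      rw [hw l k hkl (by omega), chi_eq_zero hkl (ne_pred_of_par_ne hp), zero_smul]
    obtain ⟨d, hd, d', hd', rfl⟩ := h1
    -- Applying `x` to `d + u d'` leaves only `±d'`; as `x` kills the vector, `d' = 0`.
    have h2 := hx _ hz'
    rw [map_add, hx _ (hD hd), x_u_odd ρ hkl hp (hle (hD hd')), hx _ (hD hd'), map_zero, neg_zero,
      zero_add, zero_add, smul_eq_zero] at h2
    rw [h2.resolve_left (by simp), map_zero, add_zero]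
    exact hd

end Partial

/-! ### Whittaker modules -/

section Whittaker

variable {E : Type*} [AddCommGroup E] [Module ℂ E] (ρ : U m n →ₐ[ℂ] Module.End ℂ E)

/-- The vectors killed by a power of an operator. -/
def locNil (y : Module.End ℂ E) : Submodule ℂ E where
  carrier := {v | ∃ k : ℕ, (y ^ k) v = 0}
  add_mem' := locNil_add
  zero_mem' := ⟨0, map_zero _⟩
  smul_mem' c v := fun ⟨k, hk⟩ => ⟨k, by rw [map_smul, hk, smul_zero]⟩

lemma mem_locNil_of_apply {y : Module.End ℂ E} {v : E} (h : y v ∈ locNil y) : v ∈ locNil y := by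
  obtain ⟨k, hk⟩ := h
  exact ⟨k + 1, by rw [pow_succ, Module.End.mul_apply, hk]⟩

lemma shifted_comm {i j : I m n} (hp : par i = par j) (k l : I m n) (v : E) :
    shifted ρ i j (ρ (e k l) v) = ρ (e k l) (shifted ρ i j v)
      + ((if j = k then ρ (e i l) else 0) - (if i = l then ρ (e k j) else 0) : Module.End ℂ E) v
    := by
  have h1 : (-1 : ℂ) ^ (epar i j * epar k l) = 1 := by
    rw [epar, hp, ← two_mul, mul_assoc, pow_mul]; simp
  rw [shifted_apply, shifted_apply, ρ_e_comm, h1, map_sub, map_smul, one_smul, one_smul]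
  split_ifs <;> simp <;> abel

/-- This is the nilpotency of `ad e_{ij}` for even `e_{ij}` with `i ≠ j`. The bracket with `e_{kl}`
involves only `e_{il}` and `e_{kj}`, whose own brackets with `e_{ij}` are zero or multiples of
`e_{ij}`, which commutes with itself. The cases are ordered so that each bracket falls under an
earlier one. -/
lemma ρ_e_mem_locNil {i j : I m n} (hp : par i = par j) (hij : i ≠ j) (k l : I m n) {v : E}
    (hv : v ∈ locNil (shifted ρ i j)) : ρ (e k l) v ∈ locNil (shifted ρ i j) := by
  have h0 : ∀ v, v ∈ locNil (shifted ρ i j) → (0 : Module.End ℂ E) v ∈ locNil (shifted ρ i j) :=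
    fun v _ => zero_mem _
  have h1 : ∀ k l : I m n, j ≠ k → i ≠ l → ∀ v, v ∈ locNil (shifted ρ i j) →
      ρ (e k l) v ∈ locNil (shifted ρ i j) := by
    intro k l hk hl v hv
    refine locNil_of_commutator (w := 0) (fun v => ?_) h0 hv
    rw [shifted_comm ρ hp, if_neg hk, if_neg hl, sub_zero]
  have h2 : ∀ k l : I m n, j ≠ k → ∀ v, v ∈ locNil (shifted ρ i j) →
      ρ (e k l) v ∈ locNil (shifted ρ i j) := by
    intro k l hk v hv
    refine locNil_of_commutator (fun v => shifted_comm ρ hp k l v) (fun v hv => ?_) hv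
    rw [if_neg hk, zero_sub]
    split_ifs
    · exact neg_mem (h1 k j hk hij v hv)
    · simp
  have h3 : ∀ k l : I m n, i ≠ l → ∀ v, v ∈ locNil (shifted ρ i j) →
      ρ (e k l) v ∈ locNil (shifted ρ i j) := by
    intro k l hl v hv
    refine locNil_of_commutator (fun v => shifted_comm ρ hp k l v) (fun v hv => ?_) hv
    rw [if_neg hl, sub_zero]
    split_ifs
    · exact h1 i l hij.symm hl v hv
    · exact h0 v hv
  refine locNil_of_commutator (fun v => shifted_comm ρ hp k l v) (fun v hv => ?_) hv
  rw [LinearMap.sub_apply]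
  refine (locNil (shifted ρ i j)).sub_mem ?_ ?_
  · split_ifs
    · exact h2 i l hij.symm v hv
    · exact h0 v hv
  · split_ifs
    · exact h3 k j hij v hv
    · exact h0 v hv

lemma ρ_mem_of_gen {K : Submodule ℂ E} (h : ∀ i j, ∀ v ∈ K, ρ (e i j) v ∈ K) (a : U m n) :
    ∀ v ∈ K, ρ a v ∈ K := by
  induction a using U.induction with
  | halg c => intro v hv; rw [AlgHom.commutes, Module.algebraMap_end_apply]; exact K.smul_mem c hv
  | he i j => exact h i j
  | hmul a b ha hb => intro v hv; rw [map_mul]; exact ha _ (hb v hv)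
  | hadd a b ha hb => intro v hv; rw [map_add]; exact add_mem (ha v hv) (hb v hv)

/-- An odd `x ∈ 𝔪` has `χ(x) = 0` and `x² = 0`, so only the even matrix units need an argument. -/
lemma mem_locNil_of_even {i j : I m n} (v : E) (hij : col j < col i)
    (h : par i = par j → v ∈ locNil (shifted ρ i j)) : v ∈ locNil (shifted ρ i j) := by
  by_cases hp : par i = par j
  · exact h hp
  · refine ⟨2, ?_⟩
    rw [pow_two, Module.End.mul_apply, shifted_apply, shifted_apply,
      chi_eq_zero hij (ne_pred_of_par_ne hp), zero_smul, zero_smul, sub_zero, sub_zero,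
      x_x_odd ρ hp]

/-- The Whittaker vectors. -/
def whVec : Submodule ℂ E where
  carrier := {v | ∀ i j : I m n, col j < col i → ρ (e i j) v = chi i j • v}
  add_mem' {v w} hv hw i j h := by rw [map_add, hv i j h, hw i j h, smul_add]
  zero_mem' i j _ := by simp
  smul_mem' c v hv i j h := by rw [map_smul, hv i j h, smul_comm]

lemma whUpTo_eq_whVec (ρ : U m n →ₐ[ℂ] Module.End ℂ E) :
    whUpTo ρ ((2 * (m + n) + 2) * (2 * (m + n) + 1)) = whVec ρ :=
  le_antisymm (fun _ hv i j h => hv i j h (rank_lt_bound i j)) (fun _ hv i j h _ => hv i j h)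

lemma whVec_le_locNil {i j : I m n} (hij : col j < col i) {v : E} (hv : v ∈ whVec ρ) :
    v ∈ locNil (shifted ρ i j) :=
  ⟨1, by rw [pow_one, shifted_apply, hv i j hij, sub_self]⟩

/-- For an even matrix unit, the vectors killed by a power of the shifted operator form a
`U(𝔤)`-submodule containing all Whittaker vectors. -/
lemma isWhittaker_of_generated
    (h : ∀ K : Submodule ℂ E, (∀ a, ∀ v ∈ K, ρ a v ∈ K) → whVec ρ ≤ K → K = ⊤) :
    IsWhittaker ρ := by
  intro i j hij v
  refine mem_locNil_of_even ρ v hij fun hp => ?_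
  have h1 := h (locNil (shifted ρ i j))
    (ρ_mem_of_gen ρ fun k l v hv => ρ_e_mem_locNil ρ hp (by rintro rfl; omega) k l hv)
    (fun v hv => whVec_le_locNil ρ hij hv)
  rw [h1]
  trivial

/-- A submodule containing one stage contains the previous one, since that is generated from it by
elements of `U(𝔤)`. Descending from the Whittaker vectors to stage `0` reaches the whole space. -/
lemma IsWhittaker.eq_top {ρ : U m n →ₐ[ℂ] Module.End ℂ E} (hρ : IsWhittaker ρ)
    {K : Submodule ℂ E} (hK : ∀ a, ∀ v ∈ K, ρ a v ∈ K) (h : whVec ρ ≤ K) : K = ⊤ := by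
  have step : ∀ t, whUpTo ρ (t + 1) ≤ K → whUpTo ρ t ≤ K := by
    intro t ht
    by_cases hex : ∃ l k : I m n, col k < col l ∧ rank l k = t
    · obtain ⟨l, k, hkl, rfl⟩ := hex
      refine (whUpTo_le_iSup ρ hρ hkl).trans (iSup_le fun a => ?_)
      rintro _ ⟨d, hd, rfl⟩
      exact hK _ _ (ht hd)
    · push Not at hex
      rwa [← whUpTo_succ_of_forall_ne ρ hex]
  have all : ∀ t, whUpTo ρ t ≤ K → whUpTo ρ 0 ≤ K := by
    intro t
    induction t with
    | zero => exact id
    | succ t ih => exact fun h => ih (step t h)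
  rw [← whUpTo_eq_whVec] at h
  rw [eq_top_iff, ← whUpTo_zero ρ]
  exact all _ h

/-- An Engel-type argument: from a nonzero vector of `K` in one stage, the last nonzero vector
obtained by iterating the shifted operator lies in `K` and in the next stage. A nonzero `K`
therefore contains a nonzero Whittaker vector. -/
lemma IsWhittaker.eq_bot {ρ : U m n →ₐ[ℂ] Module.End ℂ E} (hρ : IsWhittaker ρ)
    {K : Submodule ℂ E} (hK : ∀ a, ∀ v ∈ K, ρ a v ∈ K) (h : ∀ v ∈ K, v ∈ whVec ρ → v = 0) :
    ∀ v ∈ K, v = 0 := by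
  have hKy : ∀ i j, ∀ v ∈ K, shifted ρ i j v ∈ K := fun i j v hv => by
    rw [shifted_apply]; exact sub_mem (hK _ v hv) (K.smul_mem _ hv)
  have step : ∀ t, (∀ v ∈ K, v ∈ whUpTo ρ (t + 1) → v = 0) → ∀ v ∈ K, v ∈ whUpTo ρ t → v = 0 := by
    intro t ht
    by_cases hex : ∃ l k : I m n, col k < col l ∧ rank l k = t
    · obtain ⟨l, k, hkl, rfl⟩ := hex
      intro v hv hv'
      obtain ⟨p, hp⟩ := hρ l k hkl v
      induction p generalizing v with
      | zero => exact hp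
      | succ p ih =>
        have h0 := ih _ (hKy l k v hv) (shifted_mem_whUpTo ρ hkl hv')
          (by rwa [pow_succ, Module.End.mul_apply] at hp)
        exact ht v hv (shifted_eq_zero_iff ρ hv' h0)
    · push Not at hex
      rwa [← whUpTo_succ_of_forall_ne ρ hex]
  have all : ∀ t, (∀ v ∈ K, v ∈ whUpTo ρ t → v = 0) → ∀ v ∈ K, v ∈ whUpTo ρ 0 → v = 0 := by
    intro t
    induction t with
    | zero => exact id
    | succ t ih => exact fun h => ih (step t h)
  rw [← whUpTo_eq_whVec] at h
  rw [whUpTo_zero] at all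
  exact fun v hv => all _ h v hv trivial

end Whittaker

/-! ### The Whittaker modules `Q_χ` and `Q_χ ⊗_{W_χ} M` -/

/-- The action of `U(𝔤)` on `Q_χ`. -/
def Qρ (m n : ℕ) : U m n →ₐ[ℂ] Module.End ℂ (Q m n) := Algebra.lsmul ℂ ℂ (Q m n)

lemma oneChi_mem : oneChi m n ∈ whVec (Qρ m n) := fun _ _ h => Q_rel h

lemma isWhittaker_Q : IsWhittaker (Qρ m n) := by
  refine isWhittaker_of_generated _ fun K hK hw => eq_top_iff.2 fun q _ => ?_
  obtain ⟨a, rfl⟩ := Q_exists q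
  exact hK a _ (hw oneChi_mem)

/-- The endomorphism of `Q_χ` sending `1_χ` to a given Whittaker vector. -/
def endOfWhVec {q : Q m n} (hq : q ∈ whVec (Qρ m n)) : Module.End (U m n) (Q m n) :=
  (Ichi m n).liftQ (LinearMap.toSpanSingleton (U m n) (Q m n) q) (by
    refine Submodule.span_le.2 ?_
    rintro _ ⟨i, j, hij, rfl⟩
    change (e i j - algebraMap ℂ (U m n) (chi i j)) • q = 0
    rw [sub_smul, algebraMap_smul, sub_eq_zero]
    exact hq i j hij)

lemma endOfWhVec_oneChi {q : Q m n} (hq : q ∈ whVec (Qρ m n)) : endOfWhVec hq (oneChi m n) = q :=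
  one_smul (U m n) q

/-- The action of `U(𝔤)` on `Q_χ ⊗_{W_χ} M`. -/
def qρ (M : SMod.{u} (W m n)) : U m n →ₐ[ℂ] Module.End ℂ (QtenCarrier M) :=
  Algebra.lsmul ℂ ℂ (QtenCarrier M)

/-- `q ↦ q ⊗ v`. -/
def qmkL {M : SMod.{u} (W m n)} (v : M.carrier) : Q m n →ₗ[ℂ] QtenCarrier M where
  toFun q := qmk q v
  map_add' q q' := by
    change Submodule.Quotient.mk _ = _
    rw [TensorProduct.add_tmul]; rfl
  map_smul' c q := by
    change Submodule.Quotient.mk _ = _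
    rw [← TensorProduct.smul_tmul']; rfl

/-- `v ↦ 1_χ ⊗ v`. -/
def qunit (M : SMod.{u} (W m n)) : M.carrier →ₗ[ℂ] QtenCarrier M where
  toFun v := qmk (oneChi m n) v
  map_add' q q' := by
    change Submodule.Quotient.mk _ = _
    rw [TensorProduct.tmul_add]; rfl
  map_smul' c q := by
    change Submodule.Quotient.mk _ = _
    rw [TensorProduct.tmul_smul]; rfl

lemma qmkL_mem_whUpTo {M : SMod.{u} (W m n)} (v : M.carrier) {t : ℕ} {q : Q m n}
    (hq : q ∈ whUpTo (Qρ m n) t) : qmkL v q ∈ whUpTo (qρ M) t := by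
  intro i j hij hr
  have h1 : e i j • q = chi i j • q := hq i j hij hr
  change e i j • (qmk q v : QtenCarrier M) = chi i j • qmkL v q
  rw [← map_smul, ← h1]
  rfl

lemma isWhittaker_qten (M : SMod.{u} (W m n)) : IsWhittaker (qρ M) := by
  refine isWhittaker_of_generated _ fun K hK hw => eq_top_iff.2 fun x _ => ?_
  have key : ∀ x : QtenCarrier M, x ∈ K := by
    intro x
    induction x using Qten_induction with
    | h q v =>
      obtain ⟨a, rfl⟩ := Q_exists q
      refine hK a (qmk (oneChi m n) v) (hw ?_)
      rw [← whUpTo_eq_whVec]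
      refine qmkL_mem_whUpTo v ?_
      rw [whUpTo_eq_whVec]
      exact oneChi_mem
    | hadd x y hx hy => exact add_mem hx hy
  exact key x

/-- The span of the `q ⊗ v` with `q` a partial Whittaker vector. -/
def qImage (M : SMod.{u} (W m n)) (t : ℕ) : Submodule ℂ (QtenCarrier M) :=
  ⨆ v : M.carrier, (whUpTo (Qρ m n) t).map (qmkL v)

lemma qImage_le (M : SMod.{u} (W m n)) (t : ℕ) : qImage M t ≤ whUpTo (qρ M) t := by
  refine iSup_le fun v => ?_
  rintro _ ⟨q, hq, rfl⟩
  exact qmkL_mem_whUpTo v hq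

/-- Existence of the expansion is applied in `Q_χ`, where it passes to the tensors `q ⊗ v`, and
uniqueness is applied in `Q_χ ⊗ M`. A vector of stage `t + 1` lies in `qImage M t` by induction, so
it expands with coefficients in `qImage M (t + 1)`, and uniqueness puts it there. No flatness of
`Q_χ` over `W_χ` is needed. -/
lemma whUpTo_le_qImage (M : SMod.{u} (W m n)) (t : ℕ) :
    whUpTo (qρ M) t ≤ qImage M t := by
  induction t with
  | zero =>
    intro x _
    have key : ∀ x : QtenCarrier M, x ∈ qImage M 0 := by
      intro x
      induction x using Qten_induction with
      | h q v =>
        refine Submodule.mem_iSup_of_mem v ⟨q, ?_, rfl⟩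
        rw [whUpTo_zero]
        trivial
      | hadd x y hx hy => exact add_mem hx hy
    exact key x
  | succ t ih =>
    by_cases hex : ∃ l k : I m n, col k < col l ∧ rank l k = t
    · obtain ⟨l, k, hkl, rfl⟩ := hex
      intro z hz
      refine mem_of_mem_iSup_stepFamily (qρ M) hkl (qImage_le M _) ?_ hz
      have h1 := ih (whUpTo_succ_le _ _ hz)
      have h2 : qImage M (rank l k)
          ≤ ⨆ a, (qImage M (rank l k + 1)).map ((qρ M) (stepFamily l k a)) := by
        refine iSup_le fun v => ?_
        refine (Submodule.map_mono (whUpTo_le_iSup (Qρ m n) isWhittaker_Q hkl)).trans ?_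
        rw [Submodule.map_iSup]
        refine iSup_mono fun a => ?_
        rintro _ ⟨_, ⟨q, hq, rfl⟩, rfl⟩
        exact ⟨qmkL v q, Submodule.mem_iSup_of_mem v ⟨q, hq, rfl⟩, rfl⟩
      exact h2 h1
    · push Not at hex
      rw [whUpTo_succ_of_forall_ne _ hex]
      unfold qImage
      rw [whUpTo_succ_of_forall_ne _ hex]
      exact ih

/-- Every Whittaker vector of `Q_χ ⊗_{W_χ} M` is of the form `1_χ ⊗ v`. -/
lemma exists_qunit_of_mem_whVec (M : SMod.{u} (W m n)) {x : QtenCarrier M}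
    (hx : x ∈ whVec (qρ M)) : ∃ v, qunit M v = x := by
  rw [← whUpTo_eq_whVec] at hx
  have h1 := whUpTo_le_qImage M _ hx
  have h2 : qImage M ((2 * (m + n) + 2) * (2 * (m + n) + 1)) ≤ LinearMap.range (qunit M) := by
    refine iSup_le fun v => ?_
    rw [whUpTo_eq_whVec]
    rintro _ ⟨q, hq, rfl⟩
    -- The Whittaker vector `q` is `1_χ w` for the element `w` of `W_χ` sending `1_χ` to `q`, so `q
    -- ⊗ v = 1_χ ⊗ w v`.
    refine ⟨M.ρ (MulOpposite.op (endOfWhVec hq)) v, ?_⟩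
    change qmk _ _ = _
    rw [← qmk_bal]
    change qmk (endOfWhVec hq (oneChi m n)) v = _
    rw [endOfWhVec_oneChi]
    rfl
  exact h2 h1

/-- The counit is bijective on Whittaker modules (Skryabin's equivalence). -/
lemma counit_bijective (L : SMod.{u} (U m n)) (hL : IsWhittaker L.ρ) :
    Function.Bijective (SMod.lin (counit L)) := by
  constructor
  · rw [← LinearMap.ker_eq_bot, LinearMap.ker_eq_bot']
    refine (isWhittaker_qten (whObj L)).eq_bot (K := LinearMap.ker (SMod.lin (counit L)))
      (fun a v hv => ?_) (fun x hx hx' => ?_)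
    · have h1 : SMod.lin (counit L) v = 0 := hv
      exact (SMod.lin_ρ (counit L) a v).trans (by rw [h1, map_zero])
    -- A Whittaker vector in the kernel is `1_χ ⊗ v`, and the counit sends it to `v`.
    · obtain ⟨v, rfl⟩ := exists_qunit_of_mem_whVec _ hx'
      have h1 : whEval (L := L) v (oneChi m n) = 0 := hx
      have h2 := whEval_smul_one (L := L) v 1
      rw [one_smul, map_one, h1] at h2
      have h3 : v = (0 : whSub L) := Subtype.ext h2.symm
      rw [h3]
      exact map_zero (qunit (whObj L))
  · rw [← LinearMap.range_eq_top]
    refine hL.eq_top ?_ ?_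
    · rintro a _ ⟨v, rfl⟩
      exact ⟨(qtenObj (whObj L)).ρ a v, SMod.lin_ρ _ _ _⟩
    · intro v hv
      refine ⟨qunit (whObj L) (⟨v, hv⟩ : whSub L), ?_⟩
      have h2 := whEval_smul_one (L := L) ⟨v, hv⟩ 1
      rw [one_smul, map_one] at h2
      exact h2

/-- A bijective morphism of supermodules is an isomorphism. -/
lemma isIso_of_bijective {A : Type} [Ring A] [Algebra ℂ A] [Superalgebra A] {M N : SMod.{u} A}
    (f : M ⟶ N) (hf : Function.Bijective (SMod.lin f)) : IsIso f := by
  let g := LinearEquiv.ofBijective (SMod.lin f) hf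
  have hg : ∀ v, SMod.lin f (g.symm v) = v := fun v => g.apply_symm_apply v
  have hg' : ∀ v, g.symm (SMod.lin f v) = v := fun v => g.symm_apply_apply v
  refine ⟨SMod.mk' g.symm.toLinearMap (fun a v => ?_) (fun v => ?_), ?_, ?_⟩
  · refine hf.1 ?_
    change SMod.lin f (g.symm _) = SMod.lin f (M.ρ a (g.symm v))
    rw [hg, SMod.lin_ρ, hg]
  · refine hf.1 ?_
    change SMod.lin f (g.symm _) = SMod.lin f (M.π (g.symm v))
    rw [hg, SMod.lin_π, hg]
  · exact SMod.hom_ext hg'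
  · exact SMod.hom_ext hg

/-! ### Tensoring with `V` and the invertibility of `α`. -/

/-- A vector of the standard basis of `V`. -/
def vb (a : I m n) : (V m n).carrier := (Pi.single a 1 : I m n → ℂ)

lemma V_ρ_e (i j : I m n) (v : (V m n).carrier) :
    (V m n).ρ (e i j) v = Matrix.toLin' (Matrix.single i j (1 : ℂ)) v := by
  revert v
  unfold V
  intro v
  simp only [U.lift_e]

lemma V_ρ_e_sq {i j : I m n} (hij : i ≠ j) (v : (V m n).carrier) :
    (V m n).ρ (e i j) ((V m n).ρ (e i j) v) = 0 := by
  rw [V_ρ_e, V_ρ_e]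
  have h : Matrix.toLin' (Matrix.single i j (1 : ℂ)) ∘ₗ Matrix.toLin' (Matrix.single i j (1 : ℂ))
      = 0 := by
    rw [← Matrix.toLin'_mul, Matrix.single_mul_single_of_ne _ _ _ _ hij.symm, map_zero]
  exact LinearMap.congr_fun h v

/-- For even `x = e_{ij}` the shifted operator on `L ⊗ V` is `(x - χ(x)) ⊗ 1 + 1 ⊗ x`, and `x`
squares to zero on `V`. Induction on the order of nilpotency of the shifted operator at `l` settles
`l ⊗ v`. -/
lemma isWhittaker_tens_V {L : SMod.{u} (U m n)} (hL : IsWhittaker L.ρ) :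
    IsWhittaker (tensρ L (V m n)) := by
  intro i j hij x
  refine mem_locNil_of_even _ x hij fun hp => ?_
  have hne : i ≠ j := by rintro rfl; omega
  have hs : ∀ (l : L.carrier) (v : (V m n).carrier),
      shifted (tensρ L (V m n)) i j (l ⊗ₜ[ℂ] v : L.carrier ⊗[ℂ] (V m n).carrier)
        = (shifted L.ρ i j l ⊗ₜ[ℂ] v + l ⊗ₜ[ℂ] (V m n).ρ (e i j) v :
          L.carrier ⊗[ℂ] (V m n).carrier) := by
    intro l v
    rw [shifted_apply, shifted_apply]
    have h1 : tensρ L (V m n) (e i j) (l ⊗ₜ[ℂ] v)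
        = L.ρ (e i j) l ⊗ₜ[ℂ] v + (L.π ^ epar i j) l ⊗ₜ[ℂ] (V m n).ρ (e i j) v :=
      tens_ρ_e L (V m n) i j l v
    have h2 : L.π ^ epar i j = 1 := by
      rw [L.π_pow_congr (q := 0), pow_zero]
      rw [epar, hp]; omega
    rw [h1, h2, TensorProduct.sub_tmul, TensorProduct.smul_tmul', Module.End.one_apply]
    abel
  have key : ∀ (p : ℕ) (l : L.carrier), (shifted L.ρ i j ^ p) l = 0 → ∀ v : (V m n).carrier,
      (l ⊗ₜ[ℂ] v : L.carrier ⊗[ℂ] (V m n).carrier) ∈ locNil (shifted (tensρ L (V m n)) i j) := by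
    intro p
    induction p with
    | zero =>
      intro l hl v
      rw [pow_zero, Module.End.one_apply] at hl
      rw [hl, TensorProduct.zero_tmul]
      exact zero_mem (locNil (shifted (tensρ L (V m n)) i j))
    | succ p ih =>
      intro l hl v
      rw [pow_succ, Module.End.mul_apply] at hl
      refine mem_locNil_of_apply ?_
      rw [hs]
      refine Submodule.add_mem _ (ih _ hl v) ?_
      -- The term `l ⊗ x v` has the same `l`, so the induction hypothesis does not apply yet; one
      -- more application of the operator lowers the order, since `x² = 0` on `V`.
      refine mem_locNil_of_apply ?_
      rw [hs, V_ρ_e_sq hne, TensorProduct.tmul_zero, add_zero]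
      exact ih _ hl _
  have all : ∀ x : L.carrier ⊗[ℂ] (V m n).carrier,
      x ∈ locNil (shifted (tensρ L (V m n)) i j) := by
    intro x
    induction x using TensorProduct.induction_on with
    | zero => exact zero_mem (locNil (shifted (tensρ L (V m n)) i j))
    | tmul l v =>
      obtain ⟨p, hp⟩ := hL i j hij l
      exact key p l hp v
    | add x y hx hy => exact Submodule.add_mem _ hx hy
  exact all x

instance isIso_counit_tens_V (M : SMod.{u} (W m n)) : IsIso (counit (tens (qtenObj M) (V m n))) :=
  isIso_of_bijective _ (counit_bijective _ (isWhittaker_tens_V (isWhittaker_qten M)))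

instance isIso_tensAssoc (L : SMod.{u} (U m n)) (X Y : SMod.{0} (U m n)) :
    IsIso (tensAssoc L X Y) :=
  isIso_of_bijective _ (TensorProduct.assoc ℂ L.carrier X.carrier Y.carrier).bijective

instance isIso_alpha_app (M : SMod.{u} (W m n)) : IsIso ((alpha (V m n) (V m n)).app M) := by
  change IsIso ((wh m n).map ((tensR (V m n)).map (counit (tens (qtenObj M) (V m n))))
    ≫ (wh m n).map (tensAssoc (qtenObj M) (V m n) (V m n)))
  have h1 : IsIso ((tensR (V m n)).map (counit (tens (qtenObj M) (V m n)))) :=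
    Functor.map_isIso _ _
  have h2 := Functor.map_isIso (wh m n) ((tensR (V m n)).map (counit (tens (qtenObj M) (V m n))))
  have h3 := Functor.map_isIso (wh m n) (tensAssoc (qtenObj M) (V m n) (V m n))
  exact IsIso.comp_isIso' h2 h3

instance isIso_alpha : IsIso (alpha.{u} (V m n) (V m n)) := NatIso.isIso_of_isIso_app _

/-! ### The relations on tensor powers of `V` -/

/-- The pure tensor `l ⊗ v` as an element of the supermodule `L ⊗ X`. -/
def tm {L : SMod.{u} (U m n)} {X : SMod.{0} (U m n)} :
    L.carrier →ₗ[ℂ] X.carrier →ₗ[ℂ] (tens L X).carrier :=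
  TensorProduct.mk ℂ L.carrier X.carrier

lemma V_lin_ext {E : Type*} [AddCommGroup E] [Module ℂ E] {f g : (V m n).carrier →ₗ[ℂ] E}
    (h : ∀ a, f (vb a) = g (vb a)) : f = g :=
  (Pi.basisFun ℂ (I m n)).ext (fun a => by
    rw [Pi.basisFun_apply]
    exact h a)

lemma tens_lin_ext {L : SMod.{u} (U m n)} {E : Type*} [AddCommGroup E] [Module ℂ E]
    {f g : (tens L (V m n)).carrier →ₗ[ℂ] E} (h : ∀ l a, f (tm l (vb a)) = g (tm l (vb a))) :
    f = g :=
  TensorProduct.ext (M := L.carrier) (N := (V m n).carrier)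
    (LinearMap.ext fun l => V_lin_ext fun a => h l a)

lemma tens_lin_ext₂ {L : SMod.{u} (U m n)} {E : Type*} [AddCommGroup E] [Module ℂ E]
    {f g : (tens (tens L (V m n)) (V m n)).carrier →ₗ[ℂ] E}
    (h : ∀ l a b, f (tm (tm l (vb a)) (vb b)) = g (tm (tm l (vb a)) (vb b))) : f = g := by
  refine tens_lin_ext fun x b => ?_
  exact LinearMap.congr_fun (f := f ∘ₗ tm.flip (vb b)) (g := g ∘ₗ tm.flip (vb b))
    (tens_lin_ext fun l a => h l a b) x

lemma tens_lin_ext₃ {L : SMod.{u} (U m n)} {E : Type*} [AddCommGroup E] [Module ℂ E]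
    {f g : (tens (tens (tens L (V m n)) (V m n)) (V m n)).carrier →ₗ[ℂ] E}
    (h : ∀ l a b c, f (tm (tm (tm l (vb a)) (vb b)) (vb c))
      = g (tm (tm (tm l (vb a)) (vb b)) (vb c))) : f = g := by
  refine tens_lin_ext fun x c => ?_
  exact LinearMap.congr_fun (f := f ∘ₗ tm.flip (vb c)) (g := g ∘ₗ tm.flip (vb c))
    (tens_lin_ext₂ fun l a b => h l a b c) x

lemma V_ρ_vb (i j a : I m n) : (V m n).ρ (e i j) (vb a) = if j = a then vb i else 0 := by
  rw [V_ρ_e]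
  change Matrix.toLin' (Matrix.single i j (1 : ℂ)) (Pi.single a 1) = _
  rw [Matrix.toLin'_apply, Matrix.mulVec_single_one]
  split_ifs with h
  · subst h
    change _ = (Pi.single i 1 : I m n → ℂ)
    ext k
    by_cases hk : k = i
    · subst hk; simp
    · simp [hk, Ne.symm hk]
  · change _ = (0 : I m n → ℂ)
    ext k
    simp [h]

lemma V_π_vb (a : I m n) : (V m n).π (vb a) = (-1 : ℂ) ^ par a • vb a := by
  change (fun k => (-1 : ℂ) ^ par k * (Pi.single a 1 : I m n → ℂ) k)
    = (-1 : ℂ) ^ par a • (Pi.single a 1 : I m n → ℂ)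
  ext k
  by_cases hk : k = a
  · subst hk; simp
  · simp [hk]

lemma V_π_pow_vb (p : ℕ) (a : I m n) :
    ((V m n).π ^ p) (vb a) = (-1 : ℂ) ^ (p * par a) • vb a := by
  induction p with
  | zero => simp
  | succ p ih =>
    rw [pow_succ', Module.End.mul_apply, ih, map_smul, V_π_vb, smul_smul, ← pow_add]
    congr 2; ring

lemma tens_ρ_tm (L : SMod.{u} (U m n)) (X : SMod.{0} (U m n)) (i j : I m n)
    (l : L.carrier) (v : X.carrier) :
    (tens L X).ρ (e i j) (tm l v)
      = tm (L.ρ (e i j) l) v + tm ((L.π ^ epar i j) l) (X.ρ (e i j) v) :=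
  tens_ρ_e L X i j l v

lemma tens_π_pow_tm (L : SMod.{u} (U m n)) (X : SMod.{0} (U m n)) (p : ℕ)
    (l : L.carrier) (v : X.carrier) :
    ((tens L X).π ^ p) (tm l v) = tm ((L.π ^ p) l) ((X.π ^ p) v) :=
  tens_π_pow L X p l v

lemma tensMap_tm {L L' : SMod.{u} (U m n)} {X X' : SMod.{0} (U m n)} (f : L ⟶ L') (g : X ⟶ X')
    (l : L.carrier) (v : X.carrier) :
    SMod.lin (tensMap f g) (tm l v) = tm (SMod.lin f l) (SMod.lin g v) := rfl

lemma tensAssoc_tm (L : SMod.{u} (U m n)) (X Y : SMod.{0} (U m n)) (l : L.carrier)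
    (v : X.carrier) (w : Y.carrier) :
    SMod.lin (tensAssoc L X Y) (tm (tm l v) w) = tm l (tm v w) := rfl

lemma omega_tm (L : SMod.{u} (U m n)) (l : L.carrier) (a : I m n) :
    SMod.lin (omega L (V m n)) (tm l (vb a))
      = ∑ j, (-1 : ℂ) ^ par j • tm (L.ρ (e a j) ((L.π ^ epar a j) l)) (vb j) := by
  have h : SMod.lin (omega L (V m n)) (tm l (vb a))
      = ∑ i : I m n, ∑ j : I m n, (-1 : ℂ) ^ par j •
        tm (L.ρ (e i j) ((L.π ^ epar i j) l)) ((V m n).ρ (e j i) (vb a)) := by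
    change omegaLin L (V m n) (l ⊗ₜ[ℂ] vb a) = _
    simp only [omegaLin, LinearMap.sum_apply]
    rfl
  rw [h, Finset.sum_eq_single a]
  · simp [V_ρ_vb]
  · intro i _ hi
    simp [V_ρ_vb, hi]
  · simp

/-- On `V ⊗ V`, `Ω` is the superflip; this is the link between `ŝ`, defined through `Ω`, and the
permutation of tensor factors. -/
lemma omega_V_tm (a b : I m n) :
    SMod.lin (omega (V m n) (V m n)) (tm (vb a) (vb b))
      = (-1 : ℂ) ^ (par a * par b) • tm (vb b) (vb a) := by
  rw [omega_tm, Finset.sum_eq_single a]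
  · rw [V_π_pow_vb, map_smul, V_ρ_vb, if_pos rfl, map_smul, LinearMap.smul_apply, smul_smul,
      ← pow_add]
    congr 1
    rcases par_cases a with h | h <;> rcases par_cases b with h' | h' <;> norm_num [epar, h, h']
  · intro j _ hj
    rw [V_π_pow_vb, map_smul, V_ρ_vb, if_neg hj]
    simp
  · simp

/-- The flip of the two tensor factors `V` of `(L ⊗ V) ⊗ V`. -/
def flipV (L : SMod.{u} (U m n)) :
    tens (tens L (V m n)) (V m n) ⟶ tens (tens L (V m n)) (V m n) :=
  tensAssoc L (V m n) (V m n) ≫ tensMap (𝟙 L) (omega (V m n) (V m n)) ≫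
    inv (tensAssoc L (V m n) (V m n))

lemma flipV_tm (L : SMod.{u} (U m n)) (l : L.carrier) (a b : I m n) :
    SMod.lin (flipV L) (tm (tm l (vb a)) (vb b))
      = (-1 : ℂ) ^ (par a * par b) • tm (tm l (vb b)) (vb a) := by
  have h : flipV L ≫ tensAssoc L (V m n) (V m n)
      = tensAssoc L (V m n) (V m n) ≫ tensMap (𝟙 L) (omega (V m n) (V m n)) := by
    simp [flipV]
  refine (TensorProduct.assoc ℂ L.carrier (V m n).carrier (V m n).carrier).injective ?_
  have h1 := LinearMap.congr_fun (congrArg SMod.lin h) (tm (tm l (vb a)) (vb b))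
  refine h1.trans ?_
  rw [SMod.lin_comp, LinearMap.comp_apply, tensAssoc_tm, tensMap_tm, omega_V_tm, map_smul]
  refine Eq.trans ?_ (map_smul (SMod.lin (tensAssoc L (V m n) (V m n))) _ _).symm
  rw [tensAssoc_tm]
  rfl

lemma flipV_sq (L : SMod.{u} (U m n)) : flipV L ≫ flipV L = 𝟙 _ := by
  refine SMod.lin_injective (tens_lin_ext₂ fun l a b => ?_)
  rw [SMod.lin_comp, LinearMap.comp_apply, flipV_tm, map_smul, flipV_tm, smul_smul,
    mul_comm (par b), neg_one_pow_sq, one_smul]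
  rfl

lemma flipV_braid (L : SMod.{u} (U m n)) :
    tensMap (flipV L) (𝟙 (V m n)) ≫ flipV (tens L (V m n)) ≫ tensMap (flipV L) (𝟙 (V m n))
      = flipV (tens L (V m n)) ≫ tensMap (flipV L) (𝟙 (V m n)) ≫ flipV (tens L (V m n)) := by
  refine SMod.lin_injective (tens_lin_ext₃ fun l a b c => ?_)
  have h1 : ∀ a b c : I m n, SMod.lin (tensMap (flipV L) (𝟙 (V m n)))
      (tm (tm (tm l (vb a)) (vb b)) (vb c))
      = (-1 : ℂ) ^ (par a * par b) • tm (tm (tm l (vb b)) (vb a)) (vb c) := by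
    intro a b c
    rw [tensMap_tm, flipV_tm, SMod.lin_id, LinearMap.id_apply, map_smul, LinearMap.smul_apply]
  have h2 : ∀ a b c : I m n, SMod.lin (flipV (tens L (V m n)))
      (tm (tm (tm l (vb a)) (vb b)) (vb c))
      = (-1 : ℂ) ^ (par b * par c) • tm (tm (tm l (vb a)) (vb c)) (vb b) :=
    fun a b c => flipV_tm _ _ b c
  refine (?_ : SMod.lin (tensMap (flipV L) (𝟙 (V m n))) (SMod.lin (flipV (tens L (V m n)))
    (SMod.lin (tensMap (flipV L) (𝟙 (V m n))) (tm (tm (tm l (vb a)) (vb b)) (vb c))))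
    = SMod.lin (flipV (tens L (V m n))) (SMod.lin (tensMap (flipV L) (𝟙 (V m n)))
      (SMod.lin (flipV (tens L (V m n))) (tm (tm (tm l (vb a)) (vb b)) (vb c)))))
  simp only [h1, h2, map_smul, smul_smul]
  congr 1
  ring

/-- On `(L ⊗ V) ⊗ V` the coproduct splits `Ω` into `Ω^{[1,3]} + Ω^{[2,3]}`. Moving the flip across
turns `Ω^{[1,3]}` into `Ω^{[1,2]}`, which cancels the subtracted term, while `Ω^{[2,3]}` is the flip
itself and contributes its square, the identity. -/
lemma omega_flipV (L : SMod.{u} (U m n)) :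
    flipV L ≫ omega (tens L (V m n)) (V m n) - tensMap (omega L (V m n)) (𝟙 (V m n)) ≫ flipV L
      = 𝟙 _ := by
  refine SMod.lin_injective (tens_lin_ext₂ fun l a b => ?_)
  change SMod.lin (omega (tens L (V m n)) (V m n)) (SMod.lin (flipV L) (tm (tm l (vb a)) (vb b)))
    - SMod.lin (flipV L) (SMod.lin (tensMap (omega L (V m n)) (𝟙 (V m n)))
      (tm (tm l (vb a)) (vb b))) = tm (tm l (vb a)) (vb b)
  have h1 : SMod.lin (flipV L) (SMod.lin (tensMap (omega L (V m n)) (𝟙 (V m n)))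
      (tm (tm l (vb a)) (vb b))) = ∑ j, ((-1 : ℂ) ^ par j * (-1 : ℂ) ^ (par j * par b)) •
        tm (tm (L.ρ (e a j) ((L.π ^ epar a j) l)) (vb b)) (vb j) := by
    rw [tensMap_tm, omega_tm, map_sum, LinearMap.sum_apply, map_sum]
    refine Finset.sum_congr rfl fun j _ => ?_
    rw [map_smul, LinearMap.smul_apply, map_smul, SMod.lin_id, LinearMap.id_apply, flipV_tm, smul_smul]
  -- The two summands come from letting `e_{aj}` act on `L` and on the middle factor `V`: they are
  -- the contributions of `Ω^{[1,3]}` and `Ω^{[2,3]}`.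
  have h2 : ∀ j, (-1 : ℂ) ^ par j • tm ((tens L (V m n)).ρ (e a j)
        (((tens L (V m n)).π ^ epar a j) (tm l (vb b)))) (vb j)
      = ((-1 : ℂ) ^ par j * (-1 : ℂ) ^ (epar a j * par b)) •
          tm (tm (L.ρ (e a j) ((L.π ^ epar a j) l)) (vb b)) (vb j)
        + if j = b then (-1 : ℂ) ^ (par a * par b) • tm (tm l (vb a)) (vb b) else 0 := by
    intro j
    have h3 : (L.π ^ epar a j) ((L.π ^ epar a j) l) = l := by
      rw [← Module.End.mul_apply, ← pow_add, L.π_pow_congr (q := 0) (by omega), pow_zero,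
        Module.End.one_apply]
    rw [tens_π_pow_tm, V_π_pow_vb, map_smul, map_smul, tens_ρ_tm, h3, V_ρ_vb, map_smul,
      LinearMap.smul_apply, map_add, LinearMap.add_apply, smul_smul, smul_add]
    congr 1
    split_ifs with h
    · subst h
      congr 1
      rcases par_cases a with h | h <;> rcases par_cases j with h' | h' <;> norm_num [epar, h, h']
    · simp
  rw [h1, flipV_tm, map_smul, omega_tm]
  simp only [h2]
  rw [Finset.sum_add_distrib, Finset.sum_ite_eq' Finset.univ b, if_pos (Finset.mem_univ b),
    smul_add, smul_smul, neg_one_pow_sq, one_smul, sub_eq_iff_eq_add', Finset.smul_sum]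
  congr 1
  refine Finset.sum_congr rfl fun j _ => ?_
  rw [smul_smul]
  congr 1
  rcases par_cases a with h | h <;> rcases par_cases b with h' | h' <;>
    rcases par_cases j with h'' | h'' <;> norm_num [epar, h, h', h'']

/-! ### Transfer from `U(𝔤)`-supermodules to `W_χ`-supermodules -/

/-- The flip of the two tensor factors `V` as an endomorphism of a value of `(- ⊗ V) ⊗ V`. -/
def flipT (L : SMod.{u} (U m n)) : (tensR (V m n)).obj ((tensR (V m n)).obj L) ⟶
    (tensR (V m n)).obj ((tensR (V m n)).obj L) := flipV L

/-- The value of `s` at `M` as an endomorphism of `(M ⊛ V) ⊛ V`. -/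
def sApp (M : SMod.{u} (W m n)) :
    (F m n).obj ((F m n).obj M) ⟶ (F m n).obj ((F m n).obj M) := (sNat m n).app M

lemma flipT_naturality {L L' : SMod.{u} (U m n)} (f : L ⟶ L') :
    (tensR (V m n)).map ((tensR (V m n)).map f) ≫ flipT L'
      = flipT L ≫ (tensR (V m n)).map ((tensR (V m n)).map f) := by
  refine SMod.lin_injective (tens_lin_ext₂ fun l a b => ?_)
  have h : ∀ x a b, SMod.lin ((tensR (V m n)).map ((tensR (V m n)).map f))
      (tm (tm x (vb a)) (vb b)) = tm (tm (SMod.lin f x) (vb a)) (vb b) := fun x a b => rfl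
  refine ((congrArg (SMod.lin (flipV L')) (h l a b)).trans (flipV_tm _ _ _ _)).trans ?_
  refine Eq.trans ?_
    (congrArg (SMod.lin ((tensR (V m n)).map ((tensR (V m n)).map f))) (flipV_tm L l a b)).symm
  refine Eq.trans ?_ (map_smul (SMod.lin ((tensR (V m n)).map ((tensR (V m n)).map f))) _ _).symm
  rw [h]
  rfl

instance : (qten.{u} m n).Additive where
  map_add {M N f g} := by
    refine SMod.hom_ext fun v => ?_
    have key : ∀ v : QtenCarrier M, qtenLin (f + g) v = qtenLin f v + qtenLin g v := by
      intro v
      induction v using Qten_induction with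
      | h q v =>
        rw [qtenLin_qmk, qtenLin_qmk, qtenLin_qmk]
        exact congrArg Submodule.Quotient.mk (TensorProduct.tmul_add q _ _)
      | hadd x y hx hy => rw [map_add, map_add, map_add, hx, hy]; abel
    exact key v

instance (X : SMod.{0} (U m n)) : (tensR.{u} X).Additive where
  map_add {_ _ _ _} := tens_hom_ext fun _ _ => TensorProduct.add_tmul _ _ _

instance : (wh.{u} m n).Additive where
  map_add := rfl

instance : (F.{u} m n).Additive :=
  inferInstanceAs (qten m n ⋙ tensR (V m n) ⋙ wh m n).Additive

/-- `Q_χ ⊗_{W_χ} -` is faithful on morphisms into spaces of Whittaker vectors. -/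
lemma qten_map_injective_of_wh {N : SMod.{u} (W m n)} {L : SMod.{u} (U m n)}
    {f g : N ⟶ (wh m n).obj L} (h : (qten m n).map f = (qten m n).map g) : f = g := by
  refine SMod.hom_ext fun v => ?_
  have h1 : ∀ f : N ⟶ (wh m n).obj L, SMod.lin (counit L)
      (SMod.lin ((qten m n).map f) (qunit N v)) = (show whSub L from SMod.lin f v).1 := by
    intro f
    have h2 := whEval_smul_one (L := L) (show whSub L from SMod.lin f v) 1
    rw [one_smul, map_one] at h2
    exact h2
  exact Subtype.ext ((h1 f).symm.trans ((by rw [h] : _ = _).trans (h1 g)))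

lemma qten_map_injective {N M : SMod.{u} (W m n)} {f g : N ⟶ (F m n).obj M}
    (h : (qten m n).map f = (qten m n).map g) : f = g :=
  qten_map_injective_of_wh (L := tens (qtenObj M) (V m n)) h

lemma counit_naturality {L L' : SMod.{u} (U m n)} (f : L ⟶ L') :
    (qten m n).map ((wh m n).map f) ≫ counit L' = counit L ≫ f :=
  (counitNat m n).naturality f

/-- The isomorphism `Q_χ ⊗_{W_χ} (M ⊛ V) ≅ (Q_χ ⊗_{W_χ} M) ⊗ V`. -/
def trans₁ (M : SMod.{u} (W m n)) :
    (qten m n).obj ((F m n).obj M) ⟶ (tensR (V m n)).obj ((qten m n).obj M) :=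
  counit (tens (qtenObj M) (V m n))

instance (M : SMod.{u} (W m n)) : IsIso (trans₁ M) := isIso_counit_tens_V M

/-- The isomorphism `Q_χ ⊗_{W_χ} ((M ⊛ V) ⊛ V) ≅ (Q_χ ⊗_{W_χ} M) ⊗ V ⊗ V`. -/
def trans₂ (M : SMod.{u} (W m n)) : (qten m n).obj ((F m n).obj ((F m n).obj M)) ⟶
    (tensR (V m n)).obj ((tensR (V m n)).obj ((qten m n).obj M)) :=
  trans₁ _ ≫ (tensR (V m n)).map (trans₁ M)

instance (M : SMod.{u} (W m n)) : IsIso (trans₂ M) := by unfold trans₂; infer_instance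

/-- The isomorphism `Q_χ ⊗_{W_χ} (((M ⊛ V) ⊛ V) ⊛ V) ≅ (Q_χ ⊗_{W_χ} M) ⊗ V ⊗ V ⊗ V`. -/
def trans₃ (M : SMod.{u} (W m n)) :
    (qten m n).obj ((F m n).obj ((F m n).obj ((F m n).obj M))) ⟶
    (tensR (V m n)).obj ((tensR (V m n)).obj ((tensR (V m n)).obj ((qten m n).obj M))) :=
  trans₁ _ ≫ (tensR (V m n)).map (trans₂ M)

instance (M : SMod.{u} (W m n)) : IsIso (trans₃ M) := by unfold trans₃; infer_instance

/-- `trans₃` can be peeled from either side: the definition suits `s` whiskered by `- ⊛ V`, this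
form suits `s` evaluated at `M ⊛ V`. -/
lemma trans₃_eq (M : SMod.{u} (W m n)) : trans₃ M = trans₂ ((F m n).obj M) ≫
    (tensR (V m n)).map ((tensR (V m n)).map (trans₁ M)) := by
  simp [trans₃, trans₂]

lemma map_F_trans₁ {M N : SMod.{u} (W m n)} (f : M ⟶ N) :
    (qten m n).map ((F m n).map f) ≫ trans₁ N
      = trans₁ M ≫ (tensR (V m n)).map ((qten m n).map f) :=
  counit_naturality _

lemma xNat_trans₁ (M : SMod.{u} (W m n)) :
    (qten m n).map ((xNat m n).app M) ≫ trans₁ M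
      = trans₁ M ≫ (omegaNat (V m n)).app ((qten m n).obj M) :=
  counit_naturality _

lemma F_xNat_trans₂ (M : SMod.{u} (W m n)) :
    (qten m n).map ((F m n).map ((xNat m n).app M)) ≫ trans₂ M
      = trans₂ M ≫ (tensR (V m n)).map ((omegaNat (V m n)).app ((qten m n).obj M)) := by
  rw [trans₂, ← Category.assoc, map_F_trans₁, Category.assoc, ← Functor.map_comp, xNat_trans₁,
    Functor.map_comp, Category.assoc]

lemma xNat_F_trans₂ (M : SMod.{u} (W m n)) :
    (qten m n).map ((xNat m n).app ((F m n).obj M)) ≫ trans₂ M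
      = trans₂ M ≫ (omegaNat (V m n)).app ((tensR (V m n)).obj ((qten m n).obj M)) := by
  rw [trans₂, ← Category.assoc, xNat_trans₁, Category.assoc, ← (omegaNat (V m n)).naturality,
    Category.assoc]

lemma sNat_eq : sNat.{u} m n
    = alpha (V m n) (V m n) ≫ sHat m n ≫ inv (alpha (V m n) (V m n)) :=
  dif_pos isIso_alpha

lemma sNat_sq : sNat.{u} m n ≫ sNat m n = 𝟙 _ := by
  -- `ŝ` differs from the flip only by conjugation with the associator, so its square is found from
  -- `flipV_sq` by cancelling the associator.
  have h : sHat.{u} m n ≫ sHat m n = 𝟙 _ := by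
    refine NatTrans.ext (funext fun M => ?_)
    have h1 : tensMap (𝟙 (qtenObj M)) (omega (V m n) (V m n))
        ≫ tensMap (𝟙 (qtenObj M)) (omega (V m n) (V m n)) = 𝟙 _ := by
      have h2 := flipV_sq (qtenObj M)
      simp only [flipV, Category.assoc, IsIso.inv_hom_id_assoc] at h2
      rw [← Category.assoc, ← Category.assoc, IsIso.comp_inv_eq, Category.id_comp,
        Category.assoc] at h2
      exact (cancel_epi (tensAssoc (qtenObj M) (V m n) (V m n))).1 (by
        rw [h2, Category.comp_id])
    exact ((wh m n).map_comp _ _).symm.trans ((congrArg (wh m n).map h1).trans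
      ((wh m n).map_id _))
  rw [sNat_eq]
  simp only [Category.assoc, IsIso.inv_hom_id_assoc]
  rw [← Category.assoc (sHat m n), h, Category.id_comp, IsIso.hom_inv_id]

/-- The defining identity `s ≫ α = α ≫ ŝ`, with the associator in `α` cancelled, so that `ŝ` becomes
the flip of `(L ⊗ V) ⊗ V`. -/
lemma sApp_wh_map (M : SMod.{u} (W m n)) :
    sApp M ≫ (wh m n).map ((tensR (V m n)).map (trans₁ M))
      = (wh m n).map ((tensR (V m n)).map (trans₁ M))
        ≫ (wh m n).map (flipT ((qten m n).obj M)) := by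
  have h0 : sNat.{u} m n ≫ alpha (V m n) (V m n) = alpha (V m n) (V m n) ≫ sHat m n := by
    simp [sNat_eq]
  have h1 := congrArg (fun τ => NatTrans.app τ M) h0
  have h2 : sApp M ≫ ((wh m n).map ((tensR (V m n)).map (trans₁ M))
      ≫ (wh m n).map (tensAssoc (qtenObj M) (V m n) (V m n)))
      = ((wh m n).map ((tensR (V m n)).map (trans₁ M))
        ≫ (wh m n).map (tensAssoc (qtenObj M) (V m n) (V m n)))
        ≫ (wh m n).map (tensMap (𝟙 (qtenObj M)) (omega (V m n) (V m n))) := h1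
  have h3 : (wh m n).map (flipV (qtenObj M))
        ≫ (wh m n).map (tensAssoc (qtenObj M) (V m n) (V m n))
      = (wh m n).map (tensAssoc (qtenObj M) (V m n) (V m n))
        ≫ (wh m n).map (tensMap (𝟙 (qtenObj M)) (omega (V m n) (V m n))) := by
    rw [← Functor.map_comp, ← Functor.map_comp]
    simp [flipV]
  have h4 : IsIso ((wh m n).map (tensAssoc (qtenObj M) (V m n) (V m n))) :=
    Functor.map_isIso _ _
  refine (cancel_mono ((wh m n).map (tensAssoc (qtenObj M) (V m n) (V m n)))).1 ?_
  refine (Category.assoc _ _ _).trans (h2.trans ?_)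
  refine (Category.assoc _ _ _).trans (Eq.trans ?_ (Category.assoc _ _ _).symm)
  exact congrArg _ h3.symm

lemma sApp_trans₂ (M : SMod.{u} (W m n)) :
    (qten m n).map (sApp M) ≫ trans₂ M
      = trans₂ M ≫ flipT ((qten m n).obj M) := by
  -- Naturality of the counit rewrites `trans₂` with `trans₁` applied first inside `Wh`, the form in
  -- which `sApp_wh_map` applies.
  have h : trans₂ M = (qten m n).map ((wh m n).map ((tensR (V m n)).map (trans₁ M)))
      ≫ counit _ := (counit_naturality _).symm
  have h1 := congrArg (qten m n).map (sApp_wh_map M)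
  have h1 := (Functor.map_comp _ _ _).symm.trans (h1.trans (Functor.map_comp _ _ _))
  rw [h]
  refine (Category.assoc _ _ _).symm.trans ((congrArg (· ≫ counit _) h1).trans ?_)
  refine (Category.assoc _ _ _).trans (Eq.trans ?_ (Category.assoc _ _ _).symm)
  exact congrArg _ (counit_naturality _)

lemma F_sApp_trans₃ (M : SMod.{u} (W m n)) :
    (qten m n).map ((F m n).map (sApp M)) ≫ trans₃ M
      = trans₃ M ≫ (tensR (V m n)).map (flipT ((qten m n).obj M)) := by
  rw [trans₃]
  refine (Category.assoc _ _ _).symm.trans ((congrArg (· ≫ _) (map_F_trans₁ _)).trans ?_)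
  refine (Category.assoc _ _ _).trans (Eq.trans ?_ (Category.assoc _ _ _).symm)
  refine congrArg _ ?_
  exact (Functor.map_comp _ _ _).symm.trans ((congrArg _ (sApp_trans₂ M)).trans
    (Functor.map_comp _ _ _))

lemma sApp_F_trans₃ (M : SMod.{u} (W m n)) :
    (qten m n).map (sApp ((F m n).obj M)) ≫ trans₃ M
      = trans₃ M ≫ flipT ((tensR (V m n)).obj ((qten m n).obj M)) := by
  rw [trans₃_eq]
  refine (Category.assoc _ _ _).symm.trans ((congrArg (· ≫ _) (sApp_trans₂ _)).trans ?_)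
  refine (Category.assoc _ _ _).trans (Eq.trans ?_ (Category.assoc _ _ _).symm)
  exact congrArg _ (flipT_naturality (trans₁ M)).symm

/-- Commuting squares paste, so a relation among the transported endomorphisms pulls back along the
isomorphisms `trans₂` and `trans₃`. -/
lemma intertwine_comp {X Y Z : SMod.{u} (W m n)} {A B C : SMod.{u} (U m n)} {f : X ⟶ Y}
    {g : Y ⟶ Z} {τX : (qten m n).obj X ⟶ A} {τY : (qten m n).obj Y ⟶ B}
    {τZ : (qten m n).obj Z ⟶ C} {f' : A ⟶ B} {g' : B ⟶ C}
    (h1 : (qten m n).map f ≫ τY = τX ≫ f') (h2 : (qten m n).map g ≫ τZ = τY ≫ g') :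
    (qten m n).map (f ≫ g) ≫ τZ = τX ≫ f' ≫ g' := by
  rw [Functor.map_comp, Category.assoc, h2, ← Category.assoc, h1, Category.assoc]

lemma omega_flipT (L : SMod.{u} (U m n)) :
    flipT L ≫ (omegaNat (V m n)).app ((tensR (V m n)).obj L)
      - (tensR (V m n)).map ((omegaNat (V m n)).app L) ≫ flipT L = 𝟙 _ :=
  omega_flipV L

lemma flipT_braid (L : SMod.{u} (U m n)) :
    (tensR (V m n)).map (flipT L) ≫ flipT ((tensR (V m n)).obj L) ≫ (tensR (V m n)).map (flipT L)
      = flipT ((tensR (V m n)).obj L) ≫ (tensR (V m n)).map (flipT L)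
        ≫ flipT ((tensR (V m n)).obj L) :=
  flipV_braid L

lemma sApp_xNat (M : SMod.{u} (W m n)) :
    sApp M ≫ (xNat m n).app ((F m n).obj M) - (F m n).map ((xNat m n).app M) ≫ sApp M = 𝟙 _ := by
  refine qten_map_injective ((cancel_mono (trans₂ M)).1 ?_)
  refine (congrArg (· ≫ trans₂ M) (Functor.map_sub (qten m n))).trans ?_
  rw [Preadditive.sub_comp, intertwine_comp (sApp_trans₂ M) (xNat_F_trans₂ M),
    intertwine_comp (F_xNat_trans₂ M) (sApp_trans₂ M), ← Preadditive.comp_sub, omega_flipT,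
    Category.comp_id]
  exact ((congrArg (· ≫ _) ((qten m n).map_id _)).trans (Category.id_comp _)).symm

lemma sApp_braid (M : SMod.{u} (W m n)) :
    (F m n).map (sApp M) ≫ sApp ((F m n).obj M) ≫ (F m n).map (sApp M)
      = sApp ((F m n).obj M) ≫ (F m n).map (sApp M) ≫ sApp ((F m n).obj M) := by
  refine qten_map_injective ((cancel_mono (trans₃ M)).1 ?_)
  have h1 := F_sApp_trans₃ M
  have h2 := sApp_F_trans₃ M
  rw [intertwine_comp h1 (intertwine_comp h2 h1), intertwine_comp h2 (intertwine_comp h1 h2),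
    flipT_braid]

/-! ### The degenerate affine Hecke algebra relations -/

/-- Applying `- ⊛ V` to endomorphisms of `- ⊛ V^{⊛ d}`. -/
def whisk (m n d : ℕ) : End (starPow.{u} m n d) →+* End (starPow.{u} m n (d + 1)) where
  toFun a := Functor.whiskerRight a (F m n)
  map_one' := Functor.whiskerRight_id' _
  map_mul' a b := Functor.whiskerRight_comp b a _
  map_zero' := NatTrans.ext (funext fun _ => (F m n).map_zero _ _)
  map_add' _ _ := NatTrans.ext (funext fun _ => (F m n).map_add)

/-- The last of the elements `x_i`. -/
def xLast (m n d : ℕ) : End (starPow.{u} m n (d + 1)) :=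
  Functor.whiskerLeft (starPow m n d) (xNat m n)

/-- The last of the elements `s_j`. -/
def sLast (m n d : ℕ) : End (starPow.{u} m n (d + 2)) :=
  Functor.whiskerLeft (starPow m n d) (sNat m n)

lemma xEnd_of_lt {d : ℕ} (i : Fin (d + 1)) (h : i.val < d) :
    xEnd.{u} m n (d + 1) i = whisk m n d (xEnd m n d ⟨i.val, h⟩) := dif_pos h

lemma xEnd_last {d : ℕ} (i : Fin (d + 1)) (h : i.val = d) :
    xEnd.{u} m n (d + 1) i = xLast m n d := dif_neg (by omega)

lemma sEnd_of_lt {d : ℕ} (j : Fin (d + 1)) (h : j.val < d) :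
    sEnd.{u} m n (d + 2) j = whisk m n (d + 1) (sEnd m n (d + 1) ⟨j.val, h⟩) := dif_pos h

lemma sEnd_last {d : ℕ} (j : Fin (d + 1)) (h : j.val = d) :
    sEnd.{u} m n (d + 2) j = sLast m n d := dif_neg (by omega)

/-- This is the interchange law: the last `x` acts only on the last factor `V`, an endomorphism of
the earlier power only on its source, and naturality of `x` makes them commute. -/
lemma xLast_comm {d : ℕ} (a : End (starPow.{u} m n d)) :
    xLast m n d * whisk m n d a = whisk m n d a * xLast m n d :=
  NatTrans.ext (funext fun M => (xNat m n).naturality (a.app M))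

lemma sLast_comm {d : ℕ} (a : End (starPow.{u} m n d)) :
    sLast m n d * whisk m n (d + 1) (whisk m n d a)
      = whisk m n (d + 1) (whisk m n d a) * sLast m n d :=
  NatTrans.ext (funext fun M => (sNat m n).naturality (a.app M))

lemma sLast_sq (d : ℕ) : sLast.{u} m n d * sLast m n d = 1 :=
  NatTrans.ext (funext fun M =>
    congrArg (fun τ => NatTrans.app τ ((starPow m n d).obj M)) (sNat_sq (m := m) (n := n)))

lemma sLast_braid (d : ℕ) :
    whisk.{u} m n (d + 2) (sLast m n d) * sLast m n (d + 1) * whisk m n (d + 2) (sLast m n d)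
      = sLast m n (d + 1) * whisk m n (d + 2) (sLast m n d) * sLast m n (d + 1) :=
  NatTrans.ext (funext fun M => sApp_braid ((starPow m n d).obj M))

/-- The product in `End` is composition of maps, `a * b = b ≫ a`, so this is `sApp_xNat` at `M ⊛
V^{⊛ d}`. -/
lemma xLast_sLast (d : ℕ) :
    xLast.{u} m n (d + 1) * sLast m n d - sLast m n d * whisk m n (d + 1) (xLast m n d) = 1 :=
  NatTrans.ext (funext fun M => sApp_xNat ((starPow m n d).obj M))

/-- If `x` and `s` satisfy the degenerate affine Hecke relations then they also satisfy the mixed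
relations in the opposite order. -/
lemma DAHARelations.mixed_op {R : Type*} [Ring R] {d : ℕ} {x : Fin d → R} {s : Fin (d - 1) → R}
    (h : DAHARelations d x s) (i : Fin (d - 1)) (j k : Fin d) (hj : j.val = i.val)
    (hk : k.val = i.val + 1) : s i * x k - x j * s i = 1 := by
  -- Multiplying the mixed relation by `s_i` on both sides and using `s_i² = 1` exchanges the roles
  -- of the two terms.
  have h1 := congrArg (fun r => s i * r * s i) (h.mixed i j k hj hk)
  simp only [mul_sub, sub_mul, mul_one, h.s_sq] at h1
  rw [mul_assoc, mul_assoc (x k), h.s_sq, mul_one, ← mul_assoc, h.s_sq, one_mul] at h1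
  exact h1

/-! ### Induction on the number of factors: a relation not involving the last factor is whiskered
from the previous power. -/

lemma xEnd_comm (m n d : ℕ) (i j : Fin d) :
    xEnd.{u} m n d i * xEnd m n d j = xEnd m n d j * xEnd m n d i := by
  induction d with
  | zero => exact i.elim0
  | succ d ih =>
    rcases Nat.lt_succ_iff_lt_or_eq.1 i.2 with hi | hi <;>
      rcases Nat.lt_succ_iff_lt_or_eq.1 j.2 with hj | hj
    · rw [xEnd_of_lt i hi, xEnd_of_lt j hj, ← map_mul, ih, map_mul]
    · rw [xEnd_of_lt i hi, xEnd_last j hj, xLast_comm]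
    · rw [xEnd_last i hi, xEnd_of_lt j hj, xLast_comm]
    · rw [xEnd_last i hi, xEnd_last j hj]

lemma sEnd_sq (m n d : ℕ) (i : Fin (d + 1)) :
    sEnd.{u} m n (d + 2) i * sEnd m n (d + 2) i = 1 := by
  induction d with
  | zero => rw [sEnd_last i (by omega), sLast_sq]
  | succ d ih =>
    rcases Nat.lt_succ_iff_lt_or_eq.1 i.2 with hi | hi
    · rw [sEnd_of_lt i hi, ← map_mul, ih, map_one]
    · rw [sEnd_last i hi, sLast_sq]

lemma sEnd_braid (m n d : ℕ) (i j : Fin (d + 1)) (hij : i.val + 1 = j.val) :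
    sEnd.{u} m n (d + 2) i * sEnd m n (d + 2) j * sEnd m n (d + 2) i
      = sEnd m n (d + 2) j * sEnd m n (d + 2) i * sEnd m n (d + 2) j := by
  induction d with
  | zero => omega
  | succ d ih =>
    have hi : i.val < d + 1 := by omega
    rcases Nat.lt_succ_iff_lt_or_eq.1 j.2 with hj | hj
    · rw [sEnd_of_lt i hi, sEnd_of_lt j hj, ← map_mul, ← map_mul,
        ih ⟨i.val, hi⟩ ⟨j.val, hj⟩ hij, map_mul, map_mul]
    · have hi' : i.val = d := by omega
      rw [sEnd_last j hj, sEnd_of_lt i hi, sEnd_last ⟨i.val, hi⟩ hi', sLast_braid]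

lemma sEnd_comm (m n d : ℕ) (i j : Fin (d + 1)) (hij : i.val + 1 < j.val) :
    sEnd.{u} m n (d + 2) i * sEnd m n (d + 2) j = sEnd m n (d + 2) j * sEnd m n (d + 2) i := by
  induction d with
  | zero => omega
  | succ d ih =>
    have hi : i.val < d + 1 := by omega
    rcases Nat.lt_succ_iff_lt_or_eq.1 j.2 with hj | hj
    · rw [sEnd_of_lt i hi, sEnd_of_lt j hj, ← map_mul, ih ⟨i.val, hi⟩ ⟨j.val, hj⟩ hij, map_mul]
    · have hi' : i.val < d := by omega
      rw [sEnd_last j hj, sEnd_of_lt i hi, sEnd_of_lt ⟨i.val, hi⟩ hi', sLast_comm]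

lemma xEnd_sEnd_comm (m n d : ℕ) (j : Fin (d + 2)) (i : Fin (d + 1)) (h : j.val ≠ i.val)
    (h' : j.val ≠ i.val + 1) :
    xEnd.{u} m n (d + 2) j * sEnd m n (d + 2) i = sEnd m n (d + 2) i * xEnd m n (d + 2) j := by
  induction d with
  | zero => omega
  | succ d ih =>
    rcases Nat.lt_succ_iff_lt_or_eq.1 i.2 with hi | hi
    · rcases Nat.lt_succ_iff_lt_or_eq.1 j.2 with hj | hj
      · rw [sEnd_of_lt i hi, xEnd_of_lt j hj, ← map_mul, ih ⟨j.val, hj⟩ ⟨i.val, hi⟩ h h', map_mul]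
      · rw [sEnd_of_lt i hi, xEnd_last j hj, xLast_comm]
    · have hj : j.val < d + 2 := by omega
      have hj' : j.val < d + 1 := by omega
      rw [sEnd_last i hi, xEnd_of_lt j hj, xEnd_of_lt ⟨j.val, hj⟩ hj', sLast_comm]

lemma xEnd_sEnd_mixed_last (m n d : ℕ) (i : Fin (d + 1)) (j k : Fin (d + 2))
    (hj : j.val = i.val) (hk : k.val = i.val + 1) (hi : i.val = d) :
    xEnd.{u} m n (d + 2) k * sEnd m n (d + 2) i - sEnd m n (d + 2) i * xEnd m n (d + 2) j = 1 := by
  have hj' : j.val < d + 1 := by omega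
  have hj'' : j.val = d := by omega
  have hk' : k.val = d + 1 := by omega
  rw [sEnd_last i hi, xEnd_of_lt j hj', xEnd_last ⟨j.val, hj'⟩ hj'', xEnd_last k hk', xLast_sLast]

lemma xEnd_sEnd_mixed (m n d : ℕ) (i : Fin (d + 1)) (j k : Fin (d + 2)) (hj : j.val = i.val)
    (hk : k.val = i.val + 1) :
    xEnd.{u} m n (d + 2) k * sEnd m n (d + 2) i - sEnd m n (d + 2) i * xEnd m n (d + 2) j = 1 := by
  induction d with
  | zero => exact xEnd_sEnd_mixed_last m n 0 i j k hj hk (by omega)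
  | succ d ih =>
    rcases Nat.lt_succ_iff_lt_or_eq.1 i.2 with hi | hi
    · have hj' : j.val < d + 2 := by omega
      have hk' : k.val < d + 2 := by omega
      rw [sEnd_of_lt i hi, xEnd_of_lt j hj', xEnd_of_lt k hk', ← map_mul, ← map_mul,
        ← RingHom.map_sub, ih ⟨i.val, hi⟩ ⟨j.val, hj'⟩ ⟨k.val, hk'⟩ hj hk, map_one]
    · exact xEnd_sEnd_mixed_last m n _ i j k hj hk hi

theorem daha_relations (m n d : ℕ) : DAHARelations d (xEnd.{u} m n d) (sEnd.{u} m n d) := by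
  -- For `d = 0, 1` there are no generators `s_j`; the index set `Fin (d - 1)` is empty by truncated
  -- subtraction.
  rcases d with _ | _ | d
  · exact ⟨fun i => i.elim0, fun i => i.elim0, fun i => i.elim0, fun i => i.elim0,
      fun i => i.elim0, fun i => i.elim0⟩
  · exact ⟨fun i => Fin.elim0 i, fun i => Fin.elim0 i, fun i => Fin.elim0 i,
      fun _ i => Fin.elim0 i, fun i => Fin.elim0 i, xEnd_comm m n 1⟩
  · exact ⟨sEnd_sq m n d, sEnd_braid m n d,
      fun i j h => h.elim (sEnd_comm m n d i j) fun h => (sEnd_comm m n d j i h).symm,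
      xEnd_sEnd_comm m n d, xEnd_sEnd_mixed m n d, xEnd_comm m n _⟩

/-- Elements satisfying the defining relations extend uniquely to a homomorphism from the
degenerate affine Hecke algebra to the opposite algebra. -/
lemma DAHARelations.existsUnique {R : Type*} [Ring R] [Algebra ℂ R] {d : ℕ} {x : Fin d → R}
    {s : Fin (d - 1) → R} (h : DAHARelations d x s) :
    ∃! Ψ : DAHA d →ₐ[ℂ] Rᵐᵒᵖ, (∀ i, Ψ (DAHA.x i) = MulOpposite.op (x i)) ∧
      (∀ j, Ψ (DAHA.s j) = MulOpposite.op (s j)) := by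
  let f : Fin d ⊕ Fin (d - 1) → Rᵐᵒᵖ :=
    Sum.elim (fun i => MulOpposite.op (x i)) (fun j => MulOpposite.op (s j))
  have hf : ∀ ⦃a b⦄, DAHARel d a b → FreeAlgebra.lift ℂ f a = FreeAlgebra.lift ℂ f b := by
    intro a b hab
    induction hab with
    | s_sq i => simp [f, ← MulOpposite.op_mul, h.s_sq]
    | braid i j hij =>
      simp [f, ← MulOpposite.op_mul, ← mul_assoc, h.braid i j hij]
    | s_comm i j hij => simp [f, ← MulOpposite.op_mul, h.s_comm i j hij]
    | x_s j i h1 h2 => simp [f, ← MulOpposite.op_mul, h.x_s j i h1 h2]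
    -- The other relations are invariant, up to symmetry, under reversing products; only the mixed
    -- one needs its reversed form.
    | mixed i j k h1 h2 =>
      simp [f, ← MulOpposite.op_mul, ← MulOpposite.op_sub, h.mixed_op i j k h1 h2]
    | x_comm i j => simp [f, ← MulOpposite.op_mul, h.x_comm i j]
  refine ⟨RingQuot.liftAlgHom ℂ ⟨FreeAlgebra.lift ℂ f, hf⟩, ⟨fun i => ?_, fun j => ?_⟩, ?_⟩
  · rw [DAHA.x, RingQuot.liftAlgHom_mkAlgHom_apply]
    simp [f]
  · rw [DAHA.s, RingQuot.liftAlgHom_mkAlgHom_apply]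
    simp [f]
  · rintro Ψ ⟨h1, h2⟩
    refine RingQuot.ringQuot_ext' ℂ _ _ (FreeAlgebra.hom_ext (funext fun p => ?_))
    rcases p with i | j
    · refine (h1 i).trans ?_
      change _ = RingQuot.liftAlgHom ℂ _ (RingQuot.mkAlgHom ℂ (DAHARel d) _)
      rw [RingQuot.liftAlgHom_mkAlgHom_apply]
      simp [f]
    · refine (h2 j).trans ?_
      change _ = RingQuot.liftAlgHom ℂ _ (RingQuot.mkAlgHom ℂ (DAHARel d) _)
      rw [RingQuot.liftAlgHom_mkAlgHom_apply]
      simp [f]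

/-- Evaluation of natural endomorphisms at an object preserves the relations. -/
lemma DAHARelations.app {C : Type*} [Category* C] {D : Type*} [Category* D] [Preadditive D]
    {G : C ⥤ D} {d : ℕ} {x : Fin d → End G} {s : Fin (d - 1) → End G} (h : DAHARelations d x s)
    (M : C) : DAHARelations d (R := End (G.obj M)) (fun i => (x i).app M) (fun j => (s j).app M) where
  s_sq i := congrArg (fun τ => NatTrans.app τ M) (h.s_sq i)
  braid i j hij := congrArg (fun τ => NatTrans.app τ M) (h.braid i j hij)
  s_comm i j hij := congrArg (fun τ => NatTrans.app τ M) (h.s_comm i j hij)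
  x_s j i h1 h2 := congrArg (fun τ => NatTrans.app τ M) (h.x_s j i h1 h2)
  mixed i j k h1 h2 := congrArg (fun τ => NatTrans.app τ M) (h.mixed i j k h1 h2)
  x_comm i j := congrArg (fun τ => NatTrans.app τ M) (h.x_comm i j)

end PrincipalW

end

theorem theorem6p1 (m n : ℕ) (hmn : m ≤ n) (d : ℕ) :
    IsIso (PrincipalW.alpha.{u} (PrincipalW.V m n) (PrincipalW.V m n)) ∧
    PrincipalW.DAHARelations d (PrincipalW.xEnd.{u} m n d) (PrincipalW.sEnd.{u} m n d) ∧
    ∀ M : PrincipalW.SMod.{u} (PrincipalW.W m n),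
      ∃! Ψ : PrincipalW.DAHA d →ₐ[ℂ] (End ((PrincipalW.starPow m n d).obj M))ᵐᵒᵖ,
        (∀ i, Ψ (PrincipalW.DAHA.x i) = MulOpposite.op ((PrincipalW.xEnd m n d i).app M)) ∧
        (∀ j, Ψ (PrincipalW.DAHA.s j) = MulOpposite.op ((PrincipalW.sEnd m n d j).app M)) :=
  ⟨PrincipalW.isIso_alpha, PrincipalW.daha_relations m n d,
    fun M => ((PrincipalW.daha_relations m n d).app M).existsUnique⟩
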